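/- Let $(V,\mu)$ be a probability space and let $\mathcal{M}$ be the set of all $M\in L_2(V\times V,\mu\times\mu)$, with complex values, that are self adjoint ($M(x,y)=\overline{M(y,x)}$ almost everywhere) and satisfy $\|M\|_\infty\le 1$. Such an $M$ acts on $L_2(V,\mu)$ by $(Mf)(x)=\int_V M(x,y)f(y)\,d\mu(y)$. For $\lambda>0$ let $[M]_\lambda\in L_2(V\times V)$ be the kernel of the operator $\sum_{|\tau|>\lambda}\tau P_\tau$, where $\tau$ ranges over the eigenvalues of $M$ with $|\tau|>\lambda$ and $P_\tau$ is the orthogonal projection of $L_2(V,\mu)$ to the (finite dimensional) eigenspace $\{f\mid Mf=\tau f\}$. The cut norm on $L_2(V\times V)$ is $$\|M\|_\square=\sup_{\|f\|_\infty,\|g\|_\infty\le 1}\left|\int_{V\times V}\overline{f(x)}\,M(x,y)\,g(y)\,d\mu(x)\,d\mu(y)\right|,$$ where $f$ and $g$ range over the complex measurable functions on $V$ with $L_\infty$ norm at most $1$. Let $\{M_i\}_{i=1}^\infty$ be a sequence in $\mathcal{M}$. Then the following two statements are equivalent. 1. $\{M_i\}_{i=1}^\infty$ is convergent in the cut norm,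 that is, there is $M\in L_2(V\times V)$ with $\lim_{i\to\infty}\|M_i-M\|_\square=0$. 2. There is a decreasing sequence $\{\alpha_j\}_{j=1}^\infty$ of positive real numbers with $\lim_{j\to\infty}\alpha_j=0$ such that, for every $j$, the sequence $\{[M_i]_{\alpha_j}\}_{i=1}^\infty$ is convergent in $L_2(V\times V)$. Furthermore, for every sequence $\{\alpha_j\}_{j=1}^\infty$ as in the second statement, the cut norm limit $M$ of $\{M_i\}_{i=1}^\infty$ is $$M=\lim_{j\to\infty}\Bigl(\lim_{i\to\infty}[M_i]_{\alpha_j}\Bigr),$$ where both limits are in $L_2(V\times V)$. -/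

import Mathlib

open MeasureTheory Filter Topology ComplexConjugate
open scoped ENNReal

set_option linter.unusedSectionVars false

noncomputable section

namespace KernelOperator

variable {V : Type*} [MeasurableSpace V] {μ : Measure V} [IsProbabilityMeasure μ]

/-- The Hilbert space `L₂(V, μ)` of complex functions on `V`. -/
abbrev Vec (μ : Measure V) : Type _ := Lp ℂ 2 μ

/-- The Hilbert–Schmidt kernel operators on `V`: the Hilbert space `L₂(V × V, μ × μ)`. -/
abbrev Kernel (μ : Measure V) : Type _ := Lp ℂ 2 (μ.prod μ)

/-- `M` is self adjoint: `M(x, y)` is the complex conjugate of `M(y, x)` almost everywhere. -/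
def IsSelfAdjointKernel (M : Kernel μ) : Prop :=
  ∀ᵐ p ∂(μ.prod μ), M p = conj (M p.swap)

/-- The set `𝓜` of self adjoint kernel operators whose `L_∞` norm is at most `1`. -/
def unitKernels (μ : Measure V) : Set (Kernel μ) :=
  {M | IsSelfAdjointKernel M ∧ ∀ᵐ p ∂(μ.prod μ), ‖M p‖ ≤ 1}

/-- The function `(M f)(x) = ∫ M(x, y) f(y) dμ(y)`. -/
def kernelApply (M : Kernel μ) (f : V → ℂ) (x : V) : ℂ :=
  ∫ y, M (x, y) * f y ∂μ

/-- `f* M g = ∫∫ conj (f(x)) M(x, y) g(y) dμ(x) dμ(y)`. -/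
def kernelForm (M : Kernel μ) (f g : V → ℂ) : ℂ :=
  ∫ p : V × V, conj (f p.1) * M p * g p.2 ∂(μ.prod μ)

/-- The values `|f* M g|`, where `f` and `g` are measurable with `L_∞` norm at most `1`. -/
def cutValues (M : Kernel μ) : Set ℝ :=
  {r | ∃ f g : V → ℂ, Measurable f ∧ Measurable g ∧
    (∀ᵐ x ∂μ, ‖f x‖ ≤ 1) ∧ (∀ᵐ x ∂μ, ‖g x‖ ≤ 1) ∧ r = ‖kernelForm M f g‖}

/-- The cut norm `‖M‖_□ = sup |f* M g|` over `‖f‖_∞, ‖g‖_∞ ≤ 1`. -/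
def cutNorm (M : Kernel μ) : ℝ := sSup (cutValues M)

/-- The sequence `M` converges to `L` in the cut norm. -/
def CutTendsto (M : ℕ → Kernel μ) (L : Kernel μ) : Prop :=
  Tendsto (fun i => cutNorm (M i - L)) atTop (𝓝 0)

/-- The supremum in the definition of the cut norm is over a nonempty bounded set. -/
theorem cutValues_nonempty (M : Kernel μ) : (cutValues M).Nonempty :=
  ⟨_, 0, 0, measurable_const, measurable_const, by simp, by simp, rfl⟩

theorem cutValues_bddAbove (M : Kernel μ) : BddAbove (cutValues M) := by
  have hM : Integrable M (μ.prod μ) := (Lp.memLp M).integrable (by norm_num)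
  refine ⟨∫ p, ‖M p‖ ∂(μ.prod μ), ?_⟩
  rintro r ⟨f, g, hf, hg, hf1, hg1, rfl⟩
  refine norm_integral_le_of_norm_le hM.norm ?_
  have h1 : ∀ᵐ p : V × V ∂(μ.prod μ), ‖f p.1‖ ≤ 1 :=
    Measure.quasiMeasurePreserving_fst.ae hf1
  have h2 : ∀ᵐ p : V × V ∂(μ.prod μ), ‖g p.2‖ ≤ 1 :=
    Measure.quasiMeasurePreserving_snd.ae hg1
  filter_upwards [h1, h2] with p hp1 hp2
  rw [norm_mul, norm_mul, RCLike.norm_conj]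
  calc ‖f p.1‖ * ‖M p‖ * ‖g p.2‖ ≤ 1 * ‖M p‖ * 1 := by gcongr
    _ = ‖M p‖ := by ring

theorem ae_integrable_apply (M : Kernel μ) (f : Vec μ) :
    ∀ᵐ x ∂μ, Integrable (fun y => M (x, y) * f y) μ := by
  have hf : MemLp (fun p : V × V => f p.2) 2 (μ.prod μ) := (Lp.memLp f).comp_snd μ
  have h : Integrable (fun p : V × V => M p * f p.2) (μ.prod μ) :=
    (Lp.memLp M).integrable_mul hf
  exact h.prod_right_ae

/-- The eigenspace `W_τ = {f ∈ L₂(V) | M f = τ f}`. -/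
def eigenspace (M : Kernel μ) (τ : ℝ) : Submodule ℂ (Vec μ) where
  carrier := {f | ∀ᵐ x ∂μ, kernelApply M f x = (τ : ℂ) * f x}
  zero_mem' := by
    filter_upwards [Lp.coeFn_zero ℂ 2 μ] with x hx
    have : kernelApply M (0 : Vec μ) x = ∫ y, (0 : ℂ) ∂μ := by
      refine integral_congr_ae ?_
      filter_upwards [Lp.coeFn_zero ℂ 2 μ] with y hy
      rw [hy, Pi.zero_apply, mul_zero]
    rw [this, hx]; simp
  add_mem' := by
    intro f g hf hg
    filter_upwards [hf, hg, ae_integrable_apply M f, ae_integrable_apply M g,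
      Lp.coeFn_add f g] with x h1 h2 h3 h4 h5
    have : kernelApply M (f + g : Vec μ) x
        = ∫ y, (M (x, y) * f y + M (x, y) * g y) ∂μ := by
      refine integral_congr_ae ?_
      filter_upwards [Lp.coeFn_add f g] with y hy
      rw [hy, Pi.add_apply, mul_add]
    rw [this, integral_add h3 h4, h5, Pi.add_apply, mul_add, ← h1, ← h2]
    rfl
  smul_mem' := by
    intro c f hf
    filter_upwards [hf, Lp.coeFn_smul c f] with x h1 h5
    have : kernelApply M (c • f : Vec μ) x = ∫ y, c * (M (x, y) * f y) ∂μ := by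
      refine integral_congr_ae ?_
      filter_upwards [Lp.coeFn_smul c f] with y hy
      rw [hy, Pi.smul_apply, smul_eq_mul]; ring
    rw [this, integral_const_mul, h5, Pi.smul_apply, smul_eq_mul]
    change c * kernelApply M f x = _
    rw [h1]; ring

theorem memLp_outer (f g : Vec μ) :
    MemLp (fun p : V × V => f p.1 * conj (g p.2)) 2 (μ.prod μ) := by
  have h1 : AEStronglyMeasurable (fun p : V × V => f p.1) (μ.prod μ) :=
    ((Lp.memLp f).comp_fst μ).1
  have h2 : AEStronglyMeasurable (fun p : V × V => g p.2) (μ.prod μ) :=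
    ((Lp.memLp g).comp_snd μ).1
  have h3 : AEStronglyMeasurable (fun p : V × V => f p.1 * conj (g p.2)) (μ.prod μ) :=
    h1.mul (Complex.continuous_conj.comp_aestronglyMeasurable h2)
  rw [memLp_two_iff_integrable_sq_norm h3]
  have hf := (memLp_two_iff_integrable_sq_norm (Lp.memLp f).1).1 (Lp.memLp f)
  have hg := (memLp_two_iff_integrable_sq_norm (Lp.memLp g).1).1 (Lp.memLp g)
  refine (hf.mul_prod hg).congr (ae_of_all _ fun p => ?_)
  simp [mul_pow]

/-- The rank one kernel operator `f g*`, with kernel `f(x) conj (g(y))`. -/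
def outer (f g : Vec μ) : Kernel μ := (memLp_outer f g).toLp _

theorem inner_outer_outer (f g h k : Vec μ) :
    inner ℂ (outer f g) (outer h k) = inner ℂ f h * inner ℂ k g := by
  rw [L2.inner_def, L2.inner_def, L2.inner_def, ← integral_prod_mul]
  refine integral_congr_ae ?_
  filter_upwards [(memLp_outer f g).coeFn_toLp, (memLp_outer h k).coeFn_toLp] with p h1 h2
  simp only [outer, h1, h2, RCLike.inner_apply, map_mul, RCLike.conj_conj]
  ring

theorem inner_outer_of_mem_eigenspace (M : Kernel μ) (τ : ℝ) {f : Vec μ}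
    (hf : f ∈ eigenspace M τ) (g : Vec μ) :
    inner ℂ (outer g f) M = (τ : ℂ) * inner ℂ g f := by
  rw [L2.inner_def, integral_prod _ (L2.integrable_inner _ _), L2.inner_def,
    ← integral_const_mul]
  refine integral_congr_ae ?_
  filter_upwards [hf, Measure.ae_ae_of_ae_prod (memLp_outer g f).coeFn_toLp] with x h1 h2
  have : ∫ y, inner ℂ (outer g f (x, y)) (M (x, y)) ∂μ
      = ∫ y, conj (g x) * (M (x, y) * f y) ∂μ := by
    refine integral_congr_ae ?_
    filter_upwards [h2] with y hy
    simp only [outer, hy, RCLike.inner_apply, map_mul, RCLike.conj_conj]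
    ring
  rw [this, integral_const_mul]
  change conj (g x) * kernelApply M f x = _
  rw [h1, RCLike.inner_apply]
  ring

/-- Eigenspaces of nonzero eigenvalues are finite dimensional. -/
theorem finiteDimensional_eigenspace (M : Kernel μ) {τ : ℝ} (hτ : τ ≠ 0) :
    FiniteDimensional ℂ (eigenspace M τ) := by
  obtain ⟨n, hn⟩ := exists_nat_ge (‖M‖ ^ 2 / τ ^ 2)
  have hpos : 0 < τ ^ 2 := by positivity
  have key : Module.rank ℂ (eigenspace M τ) ≤ n := by
    refine rank_le fun s hs => ?_
    let e := s.equivFin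
    have hs' : LinearIndependent ℂ (fun i => ((e.symm i : s) : eigenspace M τ)) :=
      hs.comp _ e.symm.injective
    have ho := InnerProductSpace.gramSchmidtNormed_orthonormal hs'
    set b := InnerProductSpace.gramSchmidtNormed ℂ
      (fun i => ((e.symm i : s) : eigenspace M τ)) with hb
    have hinner : ∀ i j, inner ℂ (b i : Vec μ) (b j : Vec μ) = if i = j then (1 : ℂ) else 0 := by
      intro i j
      exact orthonormal_iff_ite.1 ho i j
    have ho2 : Orthonormal ℂ (fun i => outer (b i : Vec μ) (b i : Vec μ)) := by
      rw [orthonormal_iff_ite]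
      intro i j
      rw [inner_outer_outer, hinner, hinner]
      by_cases h : i = j
      · simp [h]
      · simp [h]
    have hB := ho2.sum_inner_products_le M (s := Finset.univ)
    have hterm : ∀ i, ‖inner ℂ (outer (b i : Vec μ) (b i : Vec μ)) M‖ ^ 2 = τ ^ 2 := by
      intro i
      rw [inner_outer_of_mem_eigenspace M τ (b i).2, hinner]
      simp
    rw [Finset.sum_congr rfl (fun i _ => hterm i)] at hB
    simp only [Finset.sum_const, Finset.card_univ, Fintype.card_fin, nsmul_eq_mul] at hB
    have : (s.card : ℝ) ≤ n := le_trans ((le_div_iff₀ hpos).2 hB) hn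
    exact_mod_cast this
  exact Module.rank_lt_aleph0_iff.1 (key.trans_lt Cardinal.natCast_lt_aleph0)

/-- The kernel `∑ f f*`, with `f` ranging over an orthonormal basis of `W`: this is the orthogonal
projection `P_W` of `L₂(V)` to its finite dimensional subspace `W`, as a kernel operator. -/
def projKernel (W : Submodule ℂ (Vec μ)) [FiniteDimensional ℂ W] : Kernel μ :=
  ∑ i, outer (stdOrthonormalBasis ℂ W i : Vec μ) (stdOrthonormalBasis ℂ W i : Vec μ)

/-- The orthogonal projection `P_τ` to the eigenspace `W_τ` for `τ ≠ 0`, as a kernel operator. -/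
def eigenProjKernel (M : Kernel μ) (τ : ℝ) (hτ : τ ≠ 0) : Kernel μ :=
  haveI := finiteDimensional_eigenspace M hτ
  projKernel (eigenspace M τ)

/-- The truncation `[M]_lam = ∑_{|τ| > lam} τ P_τ` of a self adjoint kernel operator, for
`lam ≥ 0`. Here `τ` ranges over the nonzero reals; `P_τ = 0` unless `τ` is an eigenvalue. -/
def trunc (M : Kernel μ) (lam : ℝ) : Kernel μ :=
  ∑' τ : {τ : ℝ // τ ≠ 0 ∧ lam < |τ|}, ((τ : ℝ) : ℂ) • eigenProjKernel M τ τ.2.1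

/-- `α` is a decreasing sequence of positive reals with limit `0` such that, for every `j`, the
truncations `[M_i]_{α_j}` converge in `L₂` as `i → ∞`. -/
def IsTruncationScale (M : ℕ → Kernel μ) (α : ℕ → ℝ) : Prop :=
  Antitone α ∧ (∀ j, 0 < α j) ∧ Tendsto α atTop (𝓝 0) ∧
    ∀ j, ∃ L : Kernel μ, Tendsto (fun i => trunc (M i) (α j)) atTop (𝓝 L)

end KernelOperator

end

/-! ### Rank one kernels and the operator of a kernel -/

noncomputable section

namespace KernelOperator

variable {V : Type*} [MeasurableSpace V] {μ : Measure V} [IsProbabilityMeasure μ]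

/-! The link between the two statements is the operator norm. It always dominates the cut norm.
Conversely, if a kernel is bounded by `2`, cutting test vectors of `L₂` off at height `T` gives `‖op
K‖ ≤ T ^ 2 * cutNorm K + 4 / T` (`norm_op_le_cutNorm`). Differences of elements of `unitKernels` are
such kernels, so a cut norm convergent sequence is Cauchy in the operator norm.

From truncations to the cut norm: the eigenvalues of `K - trunc K a` are at most `a` in absolute
value, so its cut norm is at most `a`. Truncations of one kernel at two levels satisfy Pythagoras,
which passes to their limits `L j`. Hence `‖L j‖ ^ 2` is increasing and bounded, `L` is Cauchy, and
its limit is the cut norm limit (`IsTruncationScale.exists_tendsto`).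

From the cut norm to truncations: truncation at `a` can jump only when eigenvalues cross `±a`, so
thresholds in spectral gaps are needed. A kernel of norm at most `1` has at most `1 / c ^ 2`
eigenvalues beyond `c`. Among more than that many separated thresholds one lies in a gap, and by
pigeonhole a single threshold works for infinitely many `i`. A Davis–Kahan estimate makes truncation
there continuous in the operator norm. Since truncations at `a` have trace norm at most `1 / a`,
duality upgrades this to continuity in `L₂` (`norm_trunc_sub_trunc_sq_le`). -/

theorem coeFn_outer (f g : Vec μ) :
    outer f g =ᵐ[μ.prod μ] fun p => f p.1 * conj (g p.2) :=
  (memLp_outer f g).coeFn_toLp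

theorem ae_fst {p : V → Prop} (h : ∀ᵐ x ∂μ, p x) : ∀ᵐ q : V × V ∂(μ.prod μ), p q.1 :=
  Measure.quasiMeasurePreserving_fst.ae h

theorem ae_snd {p : V → Prop} (h : ∀ᵐ x ∂μ, p x) : ∀ᵐ q : V × V ∂(μ.prod μ), p q.2 :=
  Measure.quasiMeasurePreserving_snd.ae h

theorem outer_add_left (f f' g : Vec μ) : outer (f + f') g = outer f g + outer f' g := by
  refine Lp.ext ?_
  filter_upwards [coeFn_outer (f + f') g, coeFn_outer f g, coeFn_outer f' g,
    Lp.coeFn_add (outer f g) (outer f' g), ae_fst (Lp.coeFn_add f f')] with p h1 h2 h3 h4 h5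
  rw [h1, h4, Pi.add_apply, h2, h3, h5, Pi.add_apply, add_mul]

theorem outer_add_right (f g g' : Vec μ) : outer f (g + g') = outer f g + outer f g' := by
  refine Lp.ext ?_
  filter_upwards [coeFn_outer f (g + g'), coeFn_outer f g, coeFn_outer f g',
    Lp.coeFn_add (outer f g) (outer f g'), ae_snd (Lp.coeFn_add g g')] with p h1 h2 h3 h4 h5
  rw [h1, h4, Pi.add_apply, h2, h3, h5, Pi.add_apply, map_add, mul_add]

theorem outer_smul_left (c : ℂ) (f g : Vec μ) : outer (c • f) g = c • outer f g := by
  refine Lp.ext ?_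
  filter_upwards [coeFn_outer (c • f) g, coeFn_outer f g,
    Lp.coeFn_smul c (outer f g), ae_fst (Lp.coeFn_smul c f)] with p h1 h2 h4 h5
  rw [h1, h4, Pi.smul_apply, h2, h5, Pi.smul_apply, smul_eq_mul, smul_eq_mul, mul_assoc]

theorem outer_smul_right (c : ℂ) (f g : Vec μ) : outer f (c • g) = conj c • outer f g := by
  refine Lp.ext ?_
  filter_upwards [coeFn_outer f (c • g), coeFn_outer f g,
    Lp.coeFn_smul (conj c) (outer f g), ae_snd (Lp.coeFn_smul c g)] with p h1 h2 h4 h5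
  rw [h1, h4, Pi.smul_apply, h2, h5, Pi.smul_apply, smul_eq_mul, smul_eq_mul, map_mul]
  ring

theorem norm_outer (f g : Vec μ) : ‖outer f g‖ = ‖f‖ * ‖g‖ := by
  have h := inner_outer_outer f g f g
  rw [inner_self_eq_norm_sq_to_K, inner_self_eq_norm_sq_to_K, inner_self_eq_norm_sq_to_K] at h
  have h' : ‖outer f g‖ ^ 2 = (‖f‖ * ‖g‖) ^ 2 := by
    rw [mul_pow]
    exact_mod_cast h
  exact (pow_left_inj₀ (norm_nonneg _) (by positivity) two_ne_zero).1 h'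

theorem norm_inner_outer_le (K : Kernel μ) (f g : Vec μ) :
    ‖inner ℂ K (outer g f)‖ ≤ ‖K‖ * ‖f‖ * ‖g‖ :=
  (norm_inner_le_norm _ _).trans_eq (by rw [norm_outer]; ring)

/-- The bounded sesquilinear form `(f, g) ↦ ⟪M f, g⟫`. -/
def sesqForm (K : Kernel μ) : Vec μ →L⋆[ℂ] Vec μ →L[ℂ] ℂ :=
  (LinearMap.mk₂'ₛₗ (starRingEnd ℂ) (RingHom.id ℂ) (fun f g : Vec μ => inner ℂ K (outer g f))
    (fun f f' g => by rw [outer_add_right, inner_add_right])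
    (fun c f g => by rw [outer_smul_right, inner_smul_right, smul_eq_mul])
    (fun f g g' => by rw [outer_add_left, inner_add_right])
    (fun c f g => by
      rw [outer_smul_left, inner_smul_right, smul_eq_mul, RingHom.id_apply])).mkContinuous₂ ‖K‖
    (norm_inner_outer_le K)

/-- The bounded operator on `L₂(V)` with kernel `K`. -/
def op (K : Kernel μ) : Vec μ →L[ℂ] Vec μ :=
  InnerProductSpace.continuousLinearMapOfBilin (sesqForm K)

/-- The operator is defined weakly, through Riesz representation. Linearity in the kernel and norm
bounds then reduce to inner products with rank one kernels; the pointwise integral formula is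
recovered in `op_ae_eq_kernelApply`. -/
theorem inner_op_left (K : Kernel μ) (f g : Vec μ) :
    inner ℂ (op K f) g = inner ℂ K (outer g f) :=
  InnerProductSpace.continuousLinearMapOfBilin_apply (sesqForm K) f g

theorem inner_op_right (K : Kernel μ) (f g : Vec μ) :
    inner ℂ g (op K f) = inner ℂ (outer g f) K := by
  rw [← inner_conj_symm, inner_op_left, inner_conj_symm]

theorem op_add (K K' : Kernel μ) : op (K + K') = op K + op K' := by
  ext1 f
  refine ext_inner_left ℂ fun g => ?_
  rw [add_apply, inner_add_right]
  simp only [inner_op_right, inner_add_right]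

theorem op_smul (c : ℂ) (K : Kernel μ) : op (c • K) = c • op K := by
  ext1 f
  refine ext_inner_left ℂ fun g => ?_
  rw [smul_apply, inner_smul_right]
  simp only [inner_op_right, inner_smul_right]

/-- `op` as a linear map. -/
def opₗ : Kernel μ →ₗ[ℂ] Vec μ →L[ℂ] Vec μ where
  toFun := op
  map_add' := op_add
  map_smul' := op_smul

theorem op_sub (K K' : Kernel μ) : op (K - K') = op K - op K' :=
  map_sub (opₗ (μ := μ)) K K'

theorem op_sum {ι : Type*} (s : Finset ι) (K : ι → Kernel μ) :
    op (∑ i ∈ s, K i) = ∑ i ∈ s, op (K i) :=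
  map_sum (opₗ (μ := μ)) K s

theorem norm_op_le (K : Kernel μ) : ‖op K‖ ≤ ‖K‖ := by
  refine ContinuousLinearMap.opNorm_le_bound _ (norm_nonneg _) fun f => ?_
  -- Testing against `op K f` itself gives `‖op K f‖ ^ 2 ≤ ‖K‖ * ‖f‖ * ‖op K f‖`.
  have h := norm_inner_outer_le K f (op K f)
  rw [← inner_op_left, inner_self_eq_norm_sq_to_K, norm_pow] at h
  simp only [Complex.coe_algebraMap, Complex.norm_real, norm_norm] at h
  rcases (norm_nonneg (op K f)).eq_or_lt with h0 | h0
  · rw [← h0]; positivity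
  · rw [sq] at h
    exact le_of_mul_le_mul_right h h0

theorem op_outer (g h f : Vec μ) : op (outer g h) f = inner ℂ h f • g := by
  refine ext_inner_left ℂ fun k => ?_
  rw [inner_op_right, inner_outer_outer, inner_smul_right, mul_comm]

theorem norm_inner_outer_kernel_le (K : Kernel μ) (g f : Vec μ) :
    ‖inner ℂ (outer g f) K‖ ≤ ‖op K‖ * ‖f‖ * ‖g‖ := by
  rw [← inner_op_right, mul_comm]
  refine (norm_inner_le_norm _ _).trans ?_
  gcongr
  exact (op K).le_opNorm f

/-! ### Totality of rank one kernels; compactness and symmetry of the operator -/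

theorem integrable_kernel (K : Kernel μ) : Integrable K (μ.prod μ) :=
  (Lp.memLp K).integrable (by norm_num)

theorem inner_outer_eq_integral (K : Kernel μ) (g f : Vec μ) :
    inner ℂ (outer g f) K = ∫ p : V × V, conj (g p.1) * K p * f p.2 ∂(μ.prod μ) := by
  rw [L2.inner_def]
  refine integral_congr_ae ?_
  filter_upwards [coeFn_outer g f] with p hp
  rw [hp, RCLike.inner_apply, map_mul, RCLike.conj_conj]
  ring

theorem memLp_indicator {s : Set V} (hs : MeasurableSet s) :
    MemLp (s.indicator fun _ => (1 : ℂ)) 2 μ :=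
  memLp_indicator_const 2 hs 1 (Or.inr (measure_ne_top _ _))

theorem inner_outer_indicator (K : Kernel μ) {s t : Set V} (hs : MeasurableSet s)
    (ht : MeasurableSet t) :
    inner ℂ (outer ((memLp_indicator (μ := μ) hs).toLp _) ((memLp_indicator (μ := μ) ht).toLp _)) K
      = ∫ p in s ×ˢ t, K p ∂(μ.prod μ) := by
  rw [inner_outer_eq_integral, ← integral_indicator (hs.prod ht)]
  refine integral_congr_ae ?_
  filter_upwards [ae_fst (memLp_indicator (μ := μ) hs).coeFn_toLp,
    ae_snd (memLp_indicator (μ := μ) ht).coeFn_toLp] with p h1 h2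
  rw [h1, h2]
  by_cases hp1 : p.1 ∈ s <;> by_cases hp2 : p.2 ∈ t <;> simp [hp1, hp2, Set.indicator]

/-- Rectangles form a π-system generating the product σ-algebra, so the vanishing integrals extend
to all measurable sets. -/
theorem kernel_eq_zero_of_rectangles (K : Kernel μ)
    (h : ∀ s t : Set V, MeasurableSet s → MeasurableSet t →
      ∫ p in s ×ˢ t, K p ∂(μ.prod μ) = 0) : K = 0 := by
  have hint := integrable_kernel K
  refine Lp.ext ?_
  refine EventuallyEq.trans ?_ (Lp.coeFn_zero ℂ 2 (μ.prod μ)).symm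
  refine hint.ae_eq_zero_of_forall_setIntegral_eq_zero fun s hs _ => ?_
  induction s, hs using MeasurableSpace.induction_on_inter generateFrom_prod.symm
    isPiSystem_prod with
  | empty => simp
  | basic t ht =>
    obtain ⟨a, ha, b, hb, rfl⟩ := ht
    exact h a b ha hb
  | compl t ht ih =>
    have h0 := integral_add_compl ht hint
    have h1 := h Set.univ Set.univ .univ .univ
    rw [Set.univ_prod_univ, Measure.restrict_univ] at h1
    rw [ih (measure_lt_top _ _), zero_add, h1] at h0
    exact h0
  | iUnion f hd hf ih =>
    rw [integral_iUnion hf hd hint.integrableOn]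
    simp [fun i => ih i (measure_lt_top _ _)]

theorem kernel_eq_zero_of_inner_outer (K : Kernel μ)
    (h : ∀ f g : Vec μ, inner ℂ (outer g f) K = 0) : K = 0 :=
  kernel_eq_zero_of_rectangles K fun s t hs ht => by
    rw [← inner_outer_indicator K hs ht]
    exact h _ _

theorem isCompactOperator_op_outer (g h : Vec μ) : IsCompactOperator (op (outer g h)) := by
  have : (op (outer g h)) = (innerSL ℂ h).smulRight g := by
    ext1 f
    rw [op_outer]; rfl
  rw [this]
  have h1 : IsCompactOperator (innerSL ℂ h : Vec μ →L[ℂ] ℂ) := by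
    refine ⟨Metric.closedBall 0 1, isCompact_closedBall _ _, ?_⟩
    exact (innerSL ℂ h : Vec μ →L[ℂ] ℂ).continuous.continuousAt.preimage_mem_nhds
      (by simpa using Metric.closedBall_mem_nhds (0 : ℂ) one_pos)
  exact h1.clm_comp ((ContinuousLinearMap.id ℂ ℂ).smulRight g)

theorem continuous_op : Continuous (op : Kernel μ → Vec μ →L[ℂ] Vec μ) :=
  (LinearMap.mkContinuous (opₗ (μ := μ)) 1 fun K => by
    rw [one_mul]; exact norm_op_le K).continuous

/-- The kernels with compact operator form a closed subspace. It contains the rank one kernels, and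
only `0` is orthogonal to all of these. -/
theorem isCompactOperator_op (K : Kernel μ) : IsCompactOperator (op K) := by
  let S : Submodule ℂ (Kernel μ) :=
    (compactOperator (RingHom.id ℂ) (Vec μ) (Vec μ)).comap (opₗ (μ := μ))
  have hS : IsClosed (S : Set (Kernel μ)) :=
    (isClosed_setOfPred_isCompactOperator (σ₁₂ := RingHom.id ℂ) (M₁ := Vec μ)
      (M₂ := Vec μ)).preimage continuous_op
  have : Sᗮ = ⊥ := by
    rw [eq_bot_iff]
    intro L hL
    refine kernel_eq_zero_of_inner_outer L fun f g => ?_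
    exact hL _ (isCompactOperator_op_outer g f)
  have htop : S = ⊤ := by
    have : CompleteSpace S := hS.completeSpace_coe
    rwa [← Submodule.orthogonal_eq_bot_iff]
  have : K ∈ S := htop ▸ Submodule.mem_top
  exact this

theorem isSymmetric_op {K : Kernel μ} (hK : IsSelfAdjointKernel K) :
    (op K : Vec μ →ₗ[ℂ] Vec μ).IsSymmetric := by
  intro f g
  change inner ℂ (op K f) g = inner ℂ f (op K g)
  rw [← inner_conj_symm, inner_op_right, inner_op_right, inner_outer_eq_integral,
    inner_outer_eq_integral, ← integral_conj, ← integral_prod_swap]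
  refine integral_congr_ae ?_
  filter_upwards [hK] with p hp
  rw [hp]
  simp only [map_mul, RCLike.conj_conj, Prod.fst_swap, Prod.snd_swap]
  ring

/-- Both sides have the same integral over every measurable set, by testing against indicators and
Fubini. This identifies the pointwise `eigenspace` with that of `op K`, so that the abstract
spectral theorem applies. -/
theorem op_ae_eq_kernelApply (K : Kernel μ) (f : Vec μ) : op K f =ᵐ[μ] kernelApply K f := by
  have hI : Integrable (fun p : V × V => K p * f p.2) (μ.prod μ) :=
    (Lp.memLp K).integrable_mul ((Lp.memLp f).comp_snd μ)
  refine Integrable.ae_eq_of_forall_setIntegral_eq _ _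
    ((Lp.memLp (op K f)).integrable (by norm_num)) hI.integral_prod_left fun s hs _ => ?_
  have h1 := inner_op_right K f ((memLp_indicator (μ := μ) hs).toLp _)
  rw [inner_outer_eq_integral, L2.inner_def] at h1
  have hl : ∫ x, inner ℂ ((memLp_indicator (μ := μ) hs).toLp _ x) (op K f x) ∂μ
      = ∫ x in s, op K f x ∂μ := by
    rw [← integral_indicator hs]
    refine integral_congr_ae ?_
    filter_upwards [(memLp_indicator (μ := μ) hs).coeFn_toLp] with x hx
    rw [hx]
    by_cases h : x ∈ s <;> simp [h]
  rw [← hl, h1, ← integral_indicator hs]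
  have hr : ∫ p : V × V, conj ((memLp_indicator (μ := μ) hs).toLp _ p.1) * K p * f p.2 ∂(μ.prod μ)
      = ∫ p : V × V, (Prod.fst ⁻¹' s).indicator (fun p : V × V => K p * f p.2) p ∂(μ.prod μ) := by
    refine integral_congr_ae ?_
    filter_upwards [ae_fst (memLp_indicator (μ := μ) hs).coeFn_toLp] with p hp
    rw [hp]
    by_cases h : p.1 ∈ s <;> simp [h]
  rw [hr, integral_prod _ (hI.indicator (measurable_fst hs))]
  refine integral_congr_ae (ae_of_all _ fun x => ?_)
  by_cases h : x ∈ s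
  · simp [h, kernelApply]
  · simp [h]

theorem mem_eigenspace_iff {K : Kernel μ} {τ : ℝ} {f : Vec μ} :
    f ∈ eigenspace K τ ↔ op K f = (τ : ℂ) • f := by
  constructor
  · intro h
    refine Lp.ext ?_
    filter_upwards [op_ae_eq_kernelApply K f, h, Lp.coeFn_smul (τ : ℂ) f] with x h1 h2 h3
    rw [h1, h2, h3]; rfl
  · intro h
    change ∀ᵐ x ∂μ, kernelApply K f x = (τ : ℂ) * f x
    filter_upwards [op_ae_eq_kernelApply K f, Lp.coeFn_smul (τ : ℂ) f] with x h1 h3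
    rw [← h1, h, h3]; rfl

end KernelOperator

/-! ### Spectral decomposition and truncations -/

/-- If two operators act as scalars on each subspace of an orthogonal family with dense span, then
comparing the scalars compares the operators. -/
theorem OrthogonalFamily.norm_apply_le_norm_apply {ι E : Type*} [NormedAddCommGroup E]
    [InnerProductSpace ℂ E] [CompleteSpace E] {W : ι → Submodule ℂ E}
    (hW : OrthogonalFamily ℂ (fun i => W i) fun i => (W i).subtypeₗᵢ) (hd : (⨆ i, W i)ᗮ = ⊥)
    {S T : E →L[ℂ] E} {c d : ι → ℂ} (hS : ∀ i, ∀ f ∈ W i, S f = c i • f)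
    (hT : ∀ i, ∀ f ∈ W i, T f = d i • f) (hcd : ∀ i, W i ≠ ⊥ → ‖c i‖ ≤ ‖d i‖) (f : E) :
    ‖S f‖ ≤ ‖T f‖ := by
  classical
  have hdense : Dense ((⨆ i, W i : Submodule ℂ E) : Set E) := by
    rw [Submodule.dense_iff_topologicalClosure_eq_top, Submodule.topologicalClosure_eq_top_iff]
    exact hd
  have hclosed : IsClosed {f | ‖S f‖ ≤ ‖T f‖} :=
    isClosed_le S.continuous.norm T.continuous.norm
  refine hclosed.closure_subset_iff.2 (fun g hg => ?_) (hdense f)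
  obtain ⟨x, rfl⟩ := (Submodule.mem_iSup_iff_exists_dfinsupp' W g).1 hg
  -- Pythagoras on finite sums of vectors from the orthogonal family, which are dense in the whole
  -- space.
  have key : ∀ (R : E →L[ℂ] E) (r : ι → ℂ), (∀ i, ∀ f ∈ W i, R f = r i • f) →
      ‖R (x.sum fun _ xi => (xi : E))‖ ^ 2 = ∑ i ∈ x.support, ‖r i • x i‖ ^ 2 := by
    intro R r hR
    rw [← hW.norm_sum, DFinsupp.sum, map_sum]
    congr 2
    refine Finset.sum_congr rfl fun i _ => ?_
    rw [hR i _ (x i).2]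
    rfl
  change ‖S _‖ ≤ ‖T _‖
  refine (sq_le_sq₀ (norm_nonneg _) (norm_nonneg _)).1 ?_
  rw [key S c hS, key T d hT]
  refine Finset.sum_le_sum fun i hi => ?_
  rw [norm_smul, norm_smul]
  have hne : W i ≠ ⊥ := by
    intro h
    refine (DFinsupp.mem_support_iff.1 hi) (Subtype.ext ?_)
    exact (Submodule.mem_bot ℂ).1 (h ▸ (x i).2)
  have := hcd i hne
  gcongr

namespace KernelOperator

variable {V : Type*} [MeasurableSpace V] {μ : Measure V} [IsProbabilityMeasure μ]

theorem eigenspace_eq (K : Kernel μ) (τ : ℝ) :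
    eigenspace K τ = Module.End.eigenspace (op K : Vec μ →ₗ[ℂ] Vec μ) (τ : ℂ) := by
  ext f
  rw [mem_eigenspace_iff, Module.End.mem_eigenspace_iff]
  rfl

theorem orthogonalFamily_eigenspace {K : Kernel μ} (hK : IsSelfAdjointKernel K) :
    OrthogonalFamily ℂ (fun τ : ℝ => eigenspace K τ) fun τ => (eigenspace K τ).subtypeₗᵢ := by
  have h := (isSymmetric_op hK).orthogonalFamily_eigenspaces.comp Complex.ofReal_injective
  intro τ σ hne f g
  exact h hne ⟨f, eigenspace_eq K τ ▸ f.2⟩ ⟨g, eigenspace_eq K σ ▸ g.2⟩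

theorem inner_eigenspace_eq_zero {K : Kernel μ} (hK : IsSelfAdjointKernel K) {τ σ : ℝ}
    (h : τ ≠ σ) {f g : Vec μ} (hf : f ∈ eigenspace K τ) (hg : g ∈ eigenspace K σ) :
    inner ℂ f g = 0 :=
  orthogonalFamily_eigenspace hK h ⟨f, hf⟩ ⟨g, hg⟩

/-- This is the spectral theorem for compact symmetric operators. Its complex eigenvalues are real
by symmetry, and other complex numbers have trivial eigenspaces. -/
theorem orthogonal_iSup_eigenspace {K : Kernel μ} (hK : IsSelfAdjointKernel K) :
    (⨆ τ : ℝ, eigenspace K τ)ᗮ = ⊥ := by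
  rw [eq_bot_iff, ← ContinuousLinearMap.orthogonalComplement_iSup_eigenspaces_eq_bot
    (isCompactOperator_op K) (isSymmetric_op hK)]
  refine Submodule.orthogonal_le (iSup_le fun z => ?_)
  by_cases hz : Module.End.HasEigenvalue (op K : Module.End ℂ (Vec μ)) z
  · have h := Complex.conj_eq_iff_re.1 ((isSymmetric_op hK).conj_eigenvalue_eq_self hz)
    rw [← h, ← eigenspace_eq]
    exact le_iSup (fun τ : ℝ => eigenspace K τ) z.re
  · rw [Module.End.hasEigenvalue_iff, not_not] at hz
    rw [hz]
    exact bot_le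

/-- `eigenProjKernel` extended by `0` to `τ = 0`. -/
def spectralProj (K : Kernel μ) (τ : ℝ) : Kernel μ :=
  if h : τ ≠ 0 then eigenProjKernel K τ h else 0

/-- Hides the chosen basis and the finite dimensionality instance; later arguments use only some
orthonormal basis. -/
theorem exists_spectralProj_eq (K : Kernel μ) {τ : ℝ} (hτ : τ ≠ 0) :
    ∃ (n : ℕ) (b : OrthonormalBasis (Fin n) ℂ (eigenspace K τ)),
      n = Module.finrank ℂ (eigenspace K τ) ∧
      spectralProj K τ = ∑ i, outer (b i : Vec μ) (b i : Vec μ) := by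
  have := finiteDimensional_eigenspace K hτ
  refine ⟨_, stdOrthonormalBasis ℂ (eigenspace K τ), rfl, ?_⟩
  rw [spectralProj, dif_pos hτ]
  rfl

theorem inner_orthonormalBasis_coe {n : ℕ} {W : Submodule ℂ (Vec μ)}
    (b : OrthonormalBasis (Fin n) ℂ W) (i j : Fin n) :
    inner ℂ (b i : Vec μ) (b j : Vec μ) = if i = j then (1 : ℂ) else 0 :=
  orthonormal_iff_ite.1 b.orthonormal i j

theorem spectralProj_eq_zero {K : Kernel μ} {τ : ℝ} (h : eigenspace K τ = ⊥) :
    spectralProj K τ = 0 := by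
  by_cases hτ : τ ≠ 0
  · obtain ⟨n, b, -, hb⟩ := exists_spectralProj_eq K hτ
    rw [hb]
    refine Finset.sum_eq_zero fun i _ => ?_
    have : (b i : Vec μ) = 0 := (Submodule.mem_bot ℂ).1 (h ▸ (b i).2)
    rw [this, ← norm_eq_zero, norm_outer, norm_zero, zero_mul]
  · rw [spectralProj, dif_neg hτ]

theorem op_spectralProj_of_mem {K : Kernel μ} {τ : ℝ} (hτ : τ ≠ 0) {f : Vec μ}
    (hf : f ∈ eigenspace K τ) : op (spectralProj K τ) f = f := by
  obtain ⟨n, b, -, hb⟩ := exists_spectralProj_eq K hτ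
  rw [hb, op_sum, sum_apply]
  simp only [op_outer]
  have := congrArg (Submodule.subtype _) (b.sum_repr' ⟨f, hf⟩)
  rw [map_sum] at this
  exact this

theorem op_spectralProj_of_mem_of_ne {K : Kernel μ} (hK : IsSelfAdjointKernel K) {τ σ : ℝ}
    (h : τ ≠ σ) {f : Vec μ} (hf : f ∈ eigenspace K σ) : op (spectralProj K τ) f = 0 := by
  by_cases hτ : τ ≠ 0
  · obtain ⟨n, b, -, hb⟩ := exists_spectralProj_eq K hτ
    rw [hb, op_sum, sum_apply]
    refine Finset.sum_eq_zero fun i _ => ?_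
    rw [op_outer, inner_eigenspace_eq_zero hK h (b i).2 hf, zero_smul]
  · rw [spectralProj, dif_neg hτ]
    exact congrArg (fun T : Vec μ →L[ℂ] Vec μ => T f) (map_zero (opₗ (μ := μ)))

theorem inner_op_spectralProj (K : Kernel μ) (τ : ℝ) (f g : Vec μ) :
    inner ℂ (op (spectralProj K τ) f) g = inner ℂ f (op (spectralProj K τ) g) := by
  by_cases hτ : τ ≠ 0
  · obtain ⟨n, b, -, hb⟩ := exists_spectralProj_eq K hτ
    rw [hb, op_sum, sum_apply, sum_apply, sum_inner,
      inner_sum]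
    refine Finset.sum_congr rfl fun i _ => ?_
    rw [op_outer, op_outer, inner_smul_left, inner_smul_right, inner_conj_symm, mul_comm]
  · rw [spectralProj, dif_neg hτ, inner_op_left, inner_op_right, inner_zero_left, inner_zero_right]

/-- The left side is the trace of `P_τ K`, and `K` acts on the eigenspace as `τ`. -/
theorem inner_spectralProj_self_kernel (K : Kernel μ) (τ : ℝ) :
    inner ℂ (spectralProj K τ) K = (τ : ℂ) * Module.finrank ℂ (eigenspace K τ) := by
  by_cases hτ : τ ≠ 0
  · obtain ⟨n, b, hn, hb⟩ := exists_spectralProj_eq K hτ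
    rw [hb, sum_inner, ← hn]
    simp only [inner_outer_of_mem_eigenspace K τ (b _).2, inner_orthonormalBasis_coe, if_true,
      mul_one, Finset.sum_const, Finset.card_univ, Fintype.card_fin, nsmul_eq_mul]
    rw [mul_comm]
  · rw [spectralProj, dif_neg hτ, not_not.1 hτ]
    simp

theorem inner_spectralProj_self {K : Kernel μ} {τ : ℝ} (hτ : τ ≠ 0) :
    inner ℂ (spectralProj K τ) (spectralProj K τ) = (Module.finrank ℂ (eigenspace K τ) : ℂ) := by
  obtain ⟨n, b, hn, hb⟩ := exists_spectralProj_eq K hτ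
  rw [hb, sum_inner, ← hn]
  simp only [inner_sum, inner_outer_outer, inner_orthonormalBasis_coe]
  simp

theorem inner_spectralProj_of_ne {K : Kernel μ} (hK : IsSelfAdjointKernel K) {τ σ : ℝ}
    (h : τ ≠ σ) : inner ℂ (spectralProj K τ) (spectralProj K σ) = 0 := by
  by_cases hτ : τ ≠ 0
  · by_cases hσ : σ ≠ 0
    · obtain ⟨n, b, -, hb⟩ := exists_spectralProj_eq K hτ
      obtain ⟨m, b', -, hb'⟩ := exists_spectralProj_eq K hσ
      rw [hb, hb', sum_inner]
      refine Finset.sum_eq_zero fun i _ => ?_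
      rw [inner_sum]
      refine Finset.sum_eq_zero fun j _ => ?_
      rw [inner_outer_outer, inner_eigenspace_eq_zero hK h (b i).2 (b' j).2, zero_mul]
    · rw [spectralProj, spectralProj, dif_neg hσ, inner_zero_right]
  · rw [spectralProj, dif_neg hτ, inner_zero_left]

/-- Trace duality: each vector of an orthonormal basis of the eigenspace contributes at most `‖op
L‖`. -/
theorem norm_inner_spectralProj_le (K L : Kernel μ) (τ : ℝ) :
    ‖inner ℂ (spectralProj K τ) L‖ ≤ Module.finrank ℂ (eigenspace K τ) * ‖op L‖ := by
  by_cases hτ : τ ≠ 0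
  · obtain ⟨n, b, hn, hb⟩ := exists_spectralProj_eq K hτ
    rw [hb, sum_inner, ← hn]
    refine (norm_sum_le _ _).trans ?_
    refine (Finset.sum_le_card_nsmul _ _ (‖op L‖) fun i _ => ?_).trans_eq (by simp)
    refine (norm_inner_outer_kernel_le L _ _).trans_eq ?_
    have : ‖(b i : Vec μ)‖ = 1 := b.orthonormal.1 i
    rw [this, mul_one, mul_one]
  · rw [spectralProj, dif_neg hτ, inner_zero_left, norm_zero]
    positivity

/-- The kernel of `∑_{τ ∈ F} τ P_τ`. -/
def partialKernel (K : Kernel μ) (F : Finset ℝ) : Kernel μ :=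
  ∑ τ ∈ F, (τ : ℂ) • spectralProj K τ

theorem inner_partialKernel_partialKernel {K : Kernel μ} (hK : IsSelfAdjointKernel K)
    {F G : Finset ℝ} (hFG : F ⊆ G) :
    inner ℂ (partialKernel K F) (partialKernel K G)
      = ((∑ τ ∈ F, τ ^ 2 * Module.finrank ℂ (eigenspace K τ) : ℝ) : ℂ) := by
  rw [partialKernel, partialKernel, sum_inner]
  push_cast
  refine Finset.sum_congr rfl fun τ hτ => ?_
  rw [inner_sum, Finset.sum_eq_single_of_mem τ (hFG hτ)]
  · rw [inner_smul_left, inner_smul_right, Complex.conj_ofReal]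
    by_cases h : τ = 0
    · simp [h]
    · rw [inner_spectralProj_self h]
      ring
  · intro σ _ hne
    rw [inner_smul_left, inner_smul_right, inner_spectralProj_of_ne hK hne.symm, mul_zero, mul_zero]

theorem norm_partialKernel_sq {K : Kernel μ} (hK : IsSelfAdjointKernel K) (F : Finset ℝ) :
    ‖partialKernel K F‖ ^ 2 = ∑ τ ∈ F, τ ^ 2 * Module.finrank ℂ (eigenspace K τ) := by
  have h := inner_partialKernel_partialKernel hK (Finset.Subset.refl F)
  rw [inner_self_eq_norm_sq_to_K] at h
  exact Complex.ofReal_injective (by rw [Complex.ofReal_pow]; exact h)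

/-- The inner product of the partial sum with `K` is the squared norm of the partial sum, so
Cauchy–Schwarz applies. -/
theorem norm_partialKernel_le {K : Kernel μ} (hK : IsSelfAdjointKernel K) (F : Finset ℝ) :
    ‖partialKernel K F‖ ≤ ‖K‖ := by
  have h : inner ℂ (partialKernel K F) K
      = ((∑ τ ∈ F, τ ^ 2 * Module.finrank ℂ (eigenspace K τ) : ℝ) : ℂ) := by
    rw [partialKernel, sum_inner]
    push_cast
    refine Finset.sum_congr rfl fun τ _ => ?_
    rw [inner_smul_left, inner_spectralProj_self_kernel, Complex.conj_ofReal]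
    ring
  rw [← norm_partialKernel_sq hK] at h
  have h2 := norm_inner_le_norm (𝕜 := ℂ) (partialKernel K F) K
  rw [h, Complex.norm_real, Real.norm_of_nonneg (by positivity), sq] at h2
  rcases (norm_nonneg (partialKernel K F)).eq_or_lt with h0 | h0
  · rw [← h0]; positivity
  · exact le_of_mul_le_mul_left h2 h0

theorem finrank_pos_of_ne_bot {K : Kernel μ} {τ : ℝ} (hτ : τ ≠ 0) (h : eigenspace K τ ≠ ⊥) :
    1 ≤ Module.finrank ℂ (eigenspace K τ) := by
  have := finiteDimensional_eigenspace K hτ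
  exact Submodule.one_le_finrank_iff.2 h

/-- There are few eigenvalues away from `0`. -/
theorem card_eigenvalues_mul_le {K : Kernel μ} (hK : IsSelfAdjointKernel K) {a : ℝ} (ha : 0 < a)
    {F : Finset ℝ} (hF : ∀ τ ∈ F, a < |τ| ∧ eigenspace K τ ≠ ⊥) :
    (F.card : ℝ) * a ^ 2 ≤ ‖K‖ ^ 2 := by
  have h1 : ‖partialKernel K F‖ ^ 2 ≤ ‖K‖ ^ 2 := by
    gcongr
    exact norm_partialKernel_le hK F
  refine le_trans ?_ h1
  rw [norm_partialKernel_sq hK, ← nsmul_eq_mul]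
  refine Finset.card_nsmul_le_sum _ _ _ fun τ hτ => ?_
  obtain ⟨h2, h3⟩ := hF τ hτ
  have h4 : τ ≠ 0 := abs_pos.1 (ha.trans h2)
  have h5 : (1 : ℝ) ≤ Module.finrank ℂ (eigenspace K τ) := by
    exact_mod_cast finrank_pos_of_ne_bot h4 h3
  have h6 : a ^ 2 ≤ τ ^ 2 := by
    rw [← sq_abs τ]
    gcongr
  nlinarith [sq_nonneg τ]

/-- `F` is the set of eigenvalues of absolute value more than `a`. -/
def IsSpectrumAbove (K : Kernel μ) (a : ℝ) (F : Finset ℝ) : Prop :=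
  ∀ τ, τ ∈ F ↔ a < |τ| ∧ eigenspace K τ ≠ ⊥

theorem exists_isSpectrumAbove {K : Kernel μ} (hK : IsSelfAdjointKernel K) {a : ℝ} (ha : 0 < a) :
    ∃ F : Finset ℝ, IsSpectrumAbove K a F := by
  have hfin : {τ : ℝ | a < |τ| ∧ eigenspace K τ ≠ ⊥}.Finite := by
    by_contra hinf
    obtain ⟨n, hn⟩ := exists_nat_gt (‖K‖ ^ 2 / a ^ 2)
    obtain ⟨F, hF, hc⟩ := Set.Infinite.exists_subset_card_eq hinf n
    have h := card_eigenvalues_mul_le hK ha (F := F) fun τ hτ => hF hτ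
    rw [hc, ← le_div_iff₀ (by positivity)] at h
    exact absurd hn (not_lt.2 h)
  exact ⟨hfin.toFinset, fun τ => by simp⟩

theorem trunc_eq_partialKernel {K : Kernel μ} {a : ℝ} (ha : 0 < a) {F : Finset ℝ}
    (hF : IsSpectrumAbove K a F) : trunc K a = partialKernel K F := by
  classical
  have hF' : ∀ τ ∈ F, τ ≠ 0 ∧ a < |τ| := fun τ hτ =>
    ⟨abs_pos.1 (ha.trans ((hF τ).1 hτ).1), ((hF τ).1 hτ).1⟩
  have hterm : ∀ τ : {τ : ℝ // τ ≠ 0 ∧ a < |τ|},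
      ((τ : ℝ) : ℂ) • eigenProjKernel K τ τ.2.1 = ((τ : ℝ) : ℂ) • spectralProj K τ := by
    intro τ
    rw [spectralProj, dif_pos τ.2.1]
  -- Only finitely many terms are nonzero, so the `tsum` is a true sum and not its default value.
  rw [trunc, tsum_congr hterm, tsum_eq_sum (s := F.subtype fun τ => τ ≠ 0 ∧ a < |τ|)]
  · exact Finset.sum_subtype_of_mem (fun τ : ℝ => (τ : ℂ) • spectralProj K τ) hF'
  · intro τ hτ
    rw [Finset.mem_subtype, hF] at hτ
    rw [spectralProj_eq_zero, smul_zero]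
    by_contra hne
    exact hτ ⟨τ.2.2, hne⟩

/-- The spectral projection to the eigenvalues in `F`. -/
def partialProj (K : Kernel μ) (F : Finset ℝ) : Vec μ →L[ℂ] Vec μ :=
  ∑ τ ∈ F, op (spectralProj K τ)

open Classical in
-- The value `0` must be excluded from `F` because `spectralProj K 0` is `0` by convention and not
-- the projection to the kernel of the operator.
theorem partialProj_apply {K : Kernel μ} (hK : IsSelfAdjointKernel K) {F : Finset ℝ}
    (h0 : (0 : ℝ) ∉ F) {σ : ℝ} {f : Vec μ} (hf : f ∈ eigenspace K σ) :
    partialProj K F f = (if σ ∈ F then (1 : ℂ) else 0) • f := by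
  rw [partialProj, sum_apply]
  split_ifs with h
  · rw [Finset.sum_eq_single_of_mem σ h, op_spectralProj_of_mem, one_smul]
    · rintro rfl; exact h0 h
    · exact hf
    · intro τ _ hne
      exact op_spectralProj_of_mem_of_ne hK hne hf
  · rw [zero_smul]
    refine Finset.sum_eq_zero fun τ hτ => op_spectralProj_of_mem_of_ne hK ?_ hf
    rintro rfl
    exact h hτ

open Classical in
theorem op_partialKernel_apply {K : Kernel μ} (hK : IsSelfAdjointKernel K) (F : Finset ℝ)
    {σ : ℝ} {f : Vec μ} (hf : f ∈ eigenspace K σ) :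
    op (partialKernel K F) f = (if σ ∈ F then (σ : ℂ) else 0) • f := by
  rw [partialKernel, op_sum, sum_apply]
  simp only [op_smul, smul_apply]
  split_ifs with h
  · rw [Finset.sum_eq_single_of_mem σ h]
    · by_cases h0 : σ = 0
      · simp [h0]
      · rw [op_spectralProj_of_mem h0 hf]
    · intro τ _ hne
      rw [op_spectralProj_of_mem_of_ne hK hne hf, smul_zero]
  · rw [zero_smul]
    refine Finset.sum_eq_zero fun τ hτ => ?_
    rw [op_spectralProj_of_mem_of_ne hK (by rintro rfl; exact h hτ) hf, smul_zero]

theorem norm_apply_le_of_eigenspace {K : Kernel μ} (hK : IsSelfAdjointKernel K)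
    {S T : Vec μ →L[ℂ] Vec μ} {c d : ℝ → ℂ} (hS : ∀ τ, ∀ f ∈ eigenspace K τ, S f = c τ • f)
    (hT : ∀ τ, ∀ f ∈ eigenspace K τ, T f = d τ • f)
    (hcd : ∀ τ, eigenspace K τ ≠ ⊥ → ‖c τ‖ ≤ ‖d τ‖) (f : Vec μ) : ‖S f‖ ≤ ‖T f‖ :=
  (orthogonalFamily_eigenspace hK).norm_apply_le_norm_apply (orthogonal_iSup_eigenspace hK)
    hS hT hcd f

/-- Identities between functions of `K` can be checked on each eigenspace: the difference of the two
sides is dominated by the zero operator. -/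
theorem eq_of_eigenspace {K : Kernel μ} (hK : IsSelfAdjointKernel K)
    {S T : Vec μ →L[ℂ] Vec μ} (h : ∀ τ, ∀ f ∈ eigenspace K τ, S f = T f) : S = T := by
  ext1 f
  have := norm_apply_le_of_eigenspace hK (S := S - T) (T := 0) (c := 0) (d := 0)
    (fun τ f hf => by simp [h τ f hf]) (fun τ f hf => by simp) (fun _ _ => le_rfl) f
  rw [zero_apply, norm_zero, norm_le_zero_iff] at this
  exact sub_eq_zero.1 this

theorem norm_op_sub_trunc_le {K : Kernel μ} (hK : IsSelfAdjointKernel K) {a : ℝ} (ha : 0 < a) :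
    ‖op (K - trunc K a)‖ ≤ a := by
  classical
  obtain ⟨F, hF⟩ := exists_isSpectrumAbove hK ha
  rw [trunc_eq_partialKernel ha hF]
  refine ContinuousLinearMap.opNorm_le_bound _ ha.le fun f => ?_
  have h := norm_apply_le_of_eigenspace hK (S := op (K - partialKernel K F))
    (T := (a : ℂ) • ContinuousLinearMap.id ℂ (Vec μ))
    (c := fun σ => (σ : ℂ) - (if σ ∈ F then (σ : ℂ) else 0)) (d := fun _ => (a : ℂ))
    (fun σ f hf => by
      rw [op_sub, sub_apply, op_partialKernel_apply hK F hf, mem_eigenspace_iff.1 hf, sub_smul])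
    (fun σ f hf => rfl)
    (fun σ hσ => by
      split_ifs with h
      · simp
      · have : |σ| ≤ a := by
          by_contra hlt
          exact h ((hF σ).2 ⟨not_le.1 hlt, hσ⟩)
        simpa [abs_of_pos ha] using this) f
  refine h.trans_eq ?_
  change ‖(a : ℂ) • f‖ = _
  rw [norm_smul, Complex.norm_real, Real.norm_of_nonneg ha.le]

theorem norm_trunc_le {K : Kernel μ} (hK : IsSelfAdjointKernel K) {a : ℝ} (ha : 0 < a) :
    ‖trunc K a‖ ≤ ‖K‖ := by
  obtain ⟨F, hF⟩ := exists_isSpectrumAbove hK ha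
  rw [trunc_eq_partialKernel ha hF]
  exact norm_partialKernel_le hK F

theorem norm_trunc_sub_trunc_sq {K : Kernel μ} (hK : IsSelfAdjointKernel K) {a b : ℝ}
    (ha : 0 < a) (hab : a ≤ b) :
    ‖trunc K a - trunc K b‖ ^ 2 = ‖trunc K a‖ ^ 2 - ‖trunc K b‖ ^ 2 := by
  obtain ⟨F, hF⟩ := exists_isSpectrumAbove hK ha
  obtain ⟨G, hG⟩ := exists_isSpectrumAbove hK (ha.trans_le hab)
  have hsub : G ⊆ F := fun τ hτ =>
    (hF τ).2 ⟨hab.trans_lt ((hG τ).1 hτ).1, ((hG τ).1 hτ).2⟩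
  rw [trunc_eq_partialKernel ha hF, trunc_eq_partialKernel (ha.trans_le hab) hG, norm_sub_rev,
    @norm_sub_sq ℂ, inner_partialKernel_partialKernel hK hsub, ← norm_partialKernel_sq hK]
  simp only [RCLike.re_to_complex, Complex.ofReal_re]
  ring

/-- Since `|τ| ≤ τ ^ 2 / a` for the retained eigenvalues, the trace norm of the truncation is at
most `‖K‖ ^ 2 / a`. The bound is the duality of trace norm and operator norm. -/
theorem norm_inner_trunc_le {K : Kernel μ} (hK : IsSelfAdjointKernel K) {a : ℝ} (ha : 0 < a)
    (L : Kernel μ) : ‖inner ℂ (trunc K a) L‖ ≤ ‖K‖ ^ 2 / a * ‖op L‖ := by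
  obtain ⟨F, hF⟩ := exists_isSpectrumAbove hK ha
  have hsum : ∑ τ ∈ F, τ ^ 2 * Module.finrank ℂ (eigenspace K τ) ≤ ‖K‖ ^ 2 := by
    rw [← norm_partialKernel_sq hK]
    gcongr
    exact norm_partialKernel_le hK F
  rw [trunc_eq_partialKernel ha hF, partialKernel, sum_inner]
  refine (norm_sum_le _ _).trans ?_
  have h1 : ∀ τ ∈ F, ‖inner ℂ ((τ : ℂ) • spectralProj K τ) L‖
      ≤ (τ ^ 2 * Module.finrank ℂ (eigenspace K τ)) * (‖op L‖ / a) := by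
    intro τ hτ
    rw [inner_smul_left, norm_mul, Complex.conj_ofReal, Complex.norm_real, Real.norm_eq_abs]
    have h2 : |τ| ≤ τ ^ 2 / a := by
      rw [le_div_iff₀ ha, ← sq_abs, sq]
      exact mul_le_mul_of_nonneg_left ((hF τ).1 hτ).1.le (abs_nonneg _)
    calc |τ| * ‖inner ℂ (spectralProj K τ) L‖
        ≤ τ ^ 2 / a * (Module.finrank ℂ (eigenspace K τ) * ‖op L‖) := by
          gcongr
          exact norm_inner_spectralProj_le K L τ
      _ = _ := by ring
  refine (Finset.sum_le_sum h1).trans ?_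
  rw [← Finset.sum_mul]
  calc _ ≤ ‖K‖ ^ 2 * (‖op L‖ / a) := by gcongr
    _ = _ := by ring

end KernelOperator

/-! ### Perturbation of spectral projections -/

/-- One half of the Davis–Kahan estimate: if `A` is at least `a` on the range of `P`, and `B` is at
most `b` on the range of `1 - Q`, then `P (1 - Q)` is controlled by `A - B`. -/
theorem ContinuousLinearMap.mul_norm_mul_one_sub_le {E : Type*} [NormedAddCommGroup E]
    [NormedSpace ℂ E] {A B P Q : E →L[ℂ] E} {a b : ℝ} (hb : 0 ≤ b)
    (hAP : A * P = P * A) (hBQ : B * Q = Q * B) (hQ : Q * Q = Q)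
    (hP1 : ‖P‖ ≤ 1) (hQ1 : ‖1 - Q‖ ≤ 1) (hA : ∀ f, a * ‖P f‖ ≤ ‖A (P f)‖)
    (hB : ∀ f, ‖B (f - Q f)‖ ≤ b * ‖f - Q f‖) :
    (a - b) * ‖P * (1 - Q)‖ ≤ ‖A - B‖ := by
  -- Since `Q` commutes with `B`, the range of `1 - Q` is invariant under `B`. The last term is thus
  -- at most `b * ‖P * (1 - Q)‖`, to be absorbed by the lower bound `a` on the left.
  have hid : A * (P * (1 - Q)) = P * (A - B) * (1 - Q) + P * (1 - Q) * (B * (1 - Q)) := by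
    have h1 : (1 - Q) * (B * (1 - Q)) = B * (1 - Q) := by
      calc (1 - Q) * (B * (1 - Q)) = B - B * Q - Q * B + (Q * B) * Q := by noncomm_ring
        _ = B - B * Q - Q * B + B * (Q * Q) := by rw [← hBQ, mul_assoc]
        _ = B * (1 - Q) := by rw [hQ, ← hBQ]; noncomm_ring
    rw [mul_assoc P (1 - Q), h1, ← mul_assoc, hAP]
    noncomm_ring
  have hBQ' : ‖B * (1 - Q)‖ ≤ b := by
    refine ContinuousLinearMap.opNorm_le_bound _ hb fun f => ?_
    refine (hB f).trans ?_
    gcongr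
    calc ‖f - Q f‖ = ‖(1 - Q) f‖ := rfl
      _ ≤ 1 * ‖f‖ := (1 - Q).le_of_opNorm_le hQ1 f
      _ = ‖f‖ := one_mul _
  have h2 : ‖A * (P * (1 - Q))‖ ≤ ‖A - B‖ + ‖P * (1 - Q)‖ * b := by
    rw [hid]
    refine (norm_add_le _ _).trans (add_le_add ?_ ?_)
    · calc ‖P * (A - B) * (1 - Q)‖ ≤ ‖P‖ * ‖A - B‖ * ‖1 - Q‖ :=
            (norm_mul_le _ _).trans (by gcongr; exact norm_mul_le _ _)
        _ ≤ 1 * ‖A - B‖ * 1 := by gcongr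
        _ = ‖A - B‖ := by ring
    · exact (norm_mul_le _ _).trans (by gcongr)
  rcases le_or_gt a 0 with ha | ha
  · exact (mul_nonpos_of_nonpos_of_nonneg (by linarith) (norm_nonneg _)).trans (norm_nonneg _)
  have h3 : a * ‖P * (1 - Q)‖ ≤ ‖A * (P * (1 - Q))‖ := by
    rw [mul_comm, ← le_div_iff₀ ha]
    refine ContinuousLinearMap.opNorm_le_bound _ (by positivity) fun f => ?_
    have h4 := hA ((1 - Q) f)
    have h5 := (A * (P * (1 - Q))).le_opNorm f
    rw [div_mul_eq_mul_div, le_div_iff₀ ha, mul_comm]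
    exact h4.trans h5
  linarith

/-- Spectral projections at a spectral gap are stable under perturbation. -/
theorem ContinuousLinearMap.mul_norm_sub_le_of_gap {E : Type*} [NormedAddCommGroup E]
    [InnerProductSpace ℂ E] [CompleteSpace E] {A B P Q : E →L[ℂ] E} {a δ : ℝ} (hδ : 0 ≤ δ)
    (ha : δ ≤ a) (hAP : A * P = P * A) (hBQ : B * Q = Q * B) (hP : P * P = P) (hQ : Q * Q = Q)
    (hPs : IsSelfAdjoint P) (hQs : IsSelfAdjoint Q)
    (hP1 : ‖P‖ ≤ 1) (hP2 : ‖1 - P‖ ≤ 1) (hQ1 : ‖Q‖ ≤ 1) (hQ2 : ‖1 - Q‖ ≤ 1)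
    (hA : ∀ f, a * ‖P f‖ ≤ ‖A (P f)‖) (hA' : ∀ f, ‖A (f - P f)‖ ≤ a * ‖f - P f‖)
    (hB : ∀ f, (a + δ) * ‖Q f‖ ≤ ‖B (Q f)‖) (hB' : ∀ f, ‖B (f - Q f)‖ ≤ (a - δ) * ‖f - Q f‖) :
    δ * ‖P - Q‖ ≤ 2 * ‖A - B‖ := by
  -- Only `B` has a gap. The separations are `a - (a - δ)` here and `(a + δ) - a` with the roles
  -- exchanged, both equal to `δ`.
  have h1 := mul_norm_mul_one_sub_le (by linarith) hAP hBQ hQ hP1 hQ2 hA hB'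
  have h2 := mul_norm_mul_one_sub_le (by linarith) hBQ hAP hP hQ1 hP2 hB hA'
  have h3 : ‖(1 - P) * Q‖ = ‖Q * (1 - P)‖ := by
    rw [← norm_star, star_mul, star_sub, star_one, hPs.star_eq, hQs.star_eq]
  have h4 : P - Q = P * (1 - Q) - (1 - P) * Q := by noncomm_ring
  have h5 : ‖P - Q‖ ≤ ‖P * (1 - Q)‖ + ‖Q * (1 - P)‖ := by
    rw [← h3]
    nth_rewrite 1 [h4]
    exact norm_sub_le _ _
  rw [norm_sub_rev B A] at h2
  nlinarith

/-! ### Stability of truncation at a spectral gap -/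

namespace KernelOperator

variable {V : Type*} [MeasurableSpace V] {μ : Measure V} [IsProbabilityMeasure μ]

theorem isSelfAdjoint_partialProj (K : Kernel μ) (F : Finset ℝ) :
    IsSelfAdjoint (partialProj K F) := by
  rw [ContinuousLinearMap.isSelfAdjoint_iff_isSymmetric]
  intro f g
  change inner ℂ (partialProj K F f) g = inner ℂ f (partialProj K F g)
  rw [partialProj, sum_apply, sum_apply, sum_inner, inner_sum]
  exact Finset.sum_congr rfl fun τ _ => inner_op_spectralProj K τ f g

section

variable {K : Kernel μ} (hK : IsSelfAdjointKernel K) {F : Finset ℝ} (h0 : (0 : ℝ) ∉ F)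
include hK h0

theorem partialProj_mul_self : partialProj K F * partialProj K F = partialProj K F := by
  classical
  refine eq_of_eigenspace hK fun τ f hf => ?_
  change partialProj K F (partialProj K F f) = _
  rw [partialProj_apply hK h0 hf]
  split_ifs with h
  · rw [one_smul, partialProj_apply hK h0 hf, if_pos h, one_smul]
  · rw [zero_smul, map_zero]

theorem op_mul_partialProj : op K * partialProj K F = op (partialKernel K F) := by
  classical
  refine eq_of_eigenspace hK fun τ f hf => ?_
  change op K (partialProj K F f) = _
  rw [partialProj_apply hK h0 hf, op_partialKernel_apply hK F hf]
  split_ifs with h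
  · rw [one_smul, mem_eigenspace_iff.1 hf]
  · rw [zero_smul, map_zero]

theorem partialProj_mul_op : partialProj K F * op K = op (partialKernel K F) := by
  classical
  refine eq_of_eigenspace hK fun τ f hf => ?_
  change partialProj K F (op K f) = _
  rw [mem_eigenspace_iff.1 hf, map_smul, partialProj_apply hK h0 hf,
    op_partialKernel_apply hK F hf]
  split_ifs with h
  · rw [one_smul]
  · rw [zero_smul, smul_zero]

theorem norm_partialProj_le : ‖partialProj K F‖ ≤ 1 := by
  classical
  refine ContinuousLinearMap.opNorm_le_bound _ zero_le_one fun f => ?_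
  rw [one_mul]
  refine norm_apply_le_of_eigenspace hK (T := ContinuousLinearMap.id ℂ (Vec μ)) (d := 1)
    (fun τ f hf => partialProj_apply hK h0 hf) (fun τ f hf => (one_smul ℂ f).symm)
    (fun τ _ => ?_) f
  split_ifs <;> simp

theorem norm_one_sub_partialProj_le : ‖1 - partialProj K F‖ ≤ 1 := by
  classical
  refine ContinuousLinearMap.opNorm_le_bound _ zero_le_one fun f => ?_
  rw [one_mul]
  refine norm_apply_le_of_eigenspace hK (T := ContinuousLinearMap.id ℂ (Vec μ)) (d := 1)
    (c := fun τ => 1 - if τ ∈ F then (1 : ℂ) else 0)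
    (fun τ f hf => ?_) (fun τ f hf => (one_smul ℂ f).symm)
    (fun τ _ => ?_) f
  · rw [sub_apply, partialProj_apply hK h0 hf, sub_smul, one_smul]
    rfl
  · split_ifs <;> simp

theorem mul_norm_partialProj_le {a : ℝ} (ha : 0 ≤ a) (hF : ∀ τ ∈ F, eigenspace K τ ≠ ⊥ → a ≤ |τ|)
    (f : Vec μ) : a * ‖partialProj K F f‖ ≤ ‖op K (partialProj K F f)‖ := by
  classical
  have h := norm_apply_le_of_eigenspace hK (S := (a : ℂ) • partialProj K F)
    (T := op K * partialProj K F) (c := fun τ => (a : ℂ) * if τ ∈ F then (1 : ℂ) else 0)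
    (d := fun τ => if τ ∈ F then (τ : ℂ) else 0)
    (fun τ f hf => by rw [smul_apply, partialProj_apply hK h0 hf, mul_smul])
    (fun τ f hf => by rw [op_mul_partialProj hK h0, op_partialKernel_apply hK F hf])
    (fun τ hτ => by
      split_ifs with h
      · simpa [abs_of_nonneg ha] using hF τ h hτ
      · simp) f
  rw [smul_apply, norm_smul, Complex.norm_real, Real.norm_of_nonneg ha] at h
  exact h

theorem norm_op_sub_partialProj_le {b : ℝ} (hb : 0 ≤ b)
    (hF : ∀ τ ∉ F, eigenspace K τ ≠ ⊥ → |τ| ≤ b) (f : Vec μ) :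
    ‖op K (f - partialProj K F f)‖ ≤ b * ‖f - partialProj K F f‖ := by
  classical
  have h := norm_apply_le_of_eigenspace hK (S := op K * (1 - partialProj K F))
    (T := (b : ℂ) • (1 - partialProj K F))
    (c := fun τ => (τ : ℂ) - if τ ∈ F then (τ : ℂ) else 0)
    (d := fun τ => (b : ℂ) * (1 - if τ ∈ F then (1 : ℂ) else 0))
    (fun τ f hf => by
      rw [mul_sub, mul_one, op_mul_partialProj hK h0, sub_apply, op_partialKernel_apply hK F hf,
        mem_eigenspace_iff.1 hf, sub_smul])
    (fun τ f hf => by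
      rw [smul_apply, sub_apply, partialProj_apply hK h0 hf, mul_smul, sub_smul, one_smul]; rfl)
    (fun τ hτ => by
      split_ifs with h
      · simp
      · simpa [abs_of_nonneg hb] using hF τ h hτ) f
  rw [smul_apply, norm_smul, Complex.norm_real, Real.norm_of_nonneg hb] at h
  exact h

end

/-- `K` has no eigenvalue whose absolute value is within `δ` of `a`. -/
def HasGap (K : Kernel μ) (a δ : ℝ) : Prop :=
  ∀ τ, eigenspace K τ ≠ ⊥ → δ ≤ |(|τ| - a)|

/-- Truncation at a spectral gap is continuous in the operator norm. -/
theorem norm_op_trunc_sub_trunc_le {K L : Kernel μ} (hK : IsSelfAdjointKernel K)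
    (hL : IsSelfAdjointKernel L) {a δ : ℝ} (hδ : 0 < δ) (ha : δ < a) (hgap : HasGap L a δ) :
    ‖op (trunc K a - trunc L a)‖ ≤ (1 + 2 * ‖L‖ / δ) * ‖op (K - L)‖ := by
  have ha0 : 0 < a := hδ.trans ha
  obtain ⟨F, hF⟩ := exists_isSpectrumAbove hK ha0
  obtain ⟨G, hG⟩ := exists_isSpectrumAbove hL ha0
  have hF0 : (0 : ℝ) ∉ F := fun h => by
    have := ((hF 0).1 h).1
    rw [abs_zero] at this
    linarith
  have hG0 : (0 : ℝ) ∉ G := fun h => by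
    have := ((hG 0).1 h).1
    rw [abs_zero] at this
    linarith
  have hPQ : δ * ‖partialProj K F - partialProj L G‖ ≤ 2 * ‖op K - op L‖ := by
    refine ContinuousLinearMap.mul_norm_sub_le_of_gap hδ.le ha.le
      ((op_mul_partialProj hK hF0).trans (partialProj_mul_op hK hF0).symm)
      ((op_mul_partialProj hL hG0).trans (partialProj_mul_op hL hG0).symm)
      (partialProj_mul_self hK hF0) (partialProj_mul_self hL hG0)
      (isSelfAdjoint_partialProj K F) (isSelfAdjoint_partialProj L G)
      (norm_partialProj_le hK hF0) (norm_one_sub_partialProj_le hK hF0)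
      (norm_partialProj_le hL hG0) (norm_one_sub_partialProj_le hL hG0)
      (mul_norm_partialProj_le hK hF0 ha0.le fun τ hτ _ => ((hF τ).1 hτ).1.le)
      (norm_op_sub_partialProj_le hK hF0 ha0.le fun τ hτ hne => ?_)
      (mul_norm_partialProj_le hL hG0 (by linarith) fun τ hτ hne => ?_)
      (norm_op_sub_partialProj_le hL hG0 (by linarith) fun τ hτ hne => ?_)
    · by_contra h
      exact hτ ((hF τ).2 ⟨not_le.1 h, hne⟩)
    · have h1 := ((hG τ).1 hτ).1
      have h2 := hgap τ hne
      rw [abs_of_pos (by linarith)] at h2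
      linarith
    · have h1 : |τ| ≤ a := by
        by_contra h
        exact hτ ((hG τ).2 ⟨not_le.1 h, hne⟩)
      have h2 := hgap τ hne
      rw [abs_of_nonpos (by linarith)] at h2
      linarith
  rw [trunc_eq_partialKernel ha0 hF, trunc_eq_partialKernel ha0 hG, op_sub, op_sub,
    ← op_mul_partialProj hK hF0, ← op_mul_partialProj hL hG0]
  have hid : op K * partialProj K F - op L * partialProj L G
      = (op K - op L) * partialProj K F + op L * (partialProj K F - partialProj L G) := by
    noncomm_ring
  rw [hid]
  calc _ ≤ ‖op K - op L‖ * ‖partialProj K F‖ + ‖op L‖ * ‖partialProj K F - partialProj L G‖ :=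
        (norm_add_le _ _).trans (add_le_add (norm_mul_le _ _) (norm_mul_le _ _))
    _ ≤ ‖op K - op L‖ * 1 + ‖L‖ * (2 * ‖op K - op L‖ / δ) := by
        gcongr
        · exact norm_partialProj_le hK hF0
        · exact norm_op_le L
        · rw [le_div_iff₀ hδ, mul_comm]
          exact hPQ
    _ = _ := by ring

/-- Truncation at a spectral gap is continuous from the operator norm to the `L₂` norm. -/
theorem norm_trunc_sub_trunc_sq_le {K L : Kernel μ} (hK : IsSelfAdjointKernel K)
    (hL : IsSelfAdjointKernel L) (hK1 : ‖K‖ ≤ 1) (hL1 : ‖L‖ ≤ 1) {a δ : ℝ} (hδ : 0 < δ)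
    (ha : δ < a) (hgap : HasGap L a δ) :
    ‖trunc K a - trunc L a‖ ^ 2 ≤ 2 / a * (1 + 2 / δ) * ‖op (K - L)‖ := by
  have ha0 : 0 < a := hδ.trans ha
  set D := trunc K a - trunc L a with hD
  have h1 : ‖D‖ ^ 2 ≤ 2 / a * ‖op D‖ := by
    -- Pairing each truncation with `D` separately uses its bounded trace norm, so one factor `‖D‖`
    -- is traded for `‖op D‖`.
    have h2 : inner ℂ D D = inner ℂ (trunc K a) D - inner ℂ (trunc L a) D := by
      rw [← inner_sub_left]
    have h3 : ‖D‖ ^ 2 = ‖inner ℂ D D‖ := by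
      rw [inner_self_eq_norm_sq_to_K]
      simp
    rw [h3, h2]
    calc _ ≤ ‖K‖ ^ 2 / a * ‖op D‖ + ‖L‖ ^ 2 / a * ‖op D‖ :=
          (norm_sub_le _ _).trans
            (add_le_add (norm_inner_trunc_le hK ha0 D) (norm_inner_trunc_le hL ha0 D))
      _ ≤ 1 ^ 2 / a * ‖op D‖ + 1 ^ 2 / a * ‖op D‖ := by gcongr
      _ = _ := by ring
  have h4 := norm_op_trunc_sub_trunc_le hK hL hδ ha hgap
  refine h1.trans ?_
  rw [mul_assoc]
  gcongr
  refine h4.trans ?_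
  gcongr
  linarith

/-- Among sufficiently many well separated thresholds, one is at a spectral gap. -/
theorem exists_hasGap {K : Kernel μ} (hK : IsSelfAdjointKernel K) (hK1 : ‖K‖ ≤ 1) {c δ : ℝ}
    (hc : 0 < c) (hδ : 0 < δ) {n : ℕ} (hn : 1 / c ^ 2 < n) :
    ∃ k < n, HasGap K (c + (2 * k + 1) * δ) δ := by
  classical
  by_contra hcon
  -- The open intervals of radius `δ` about the thresholds are disjoint and lie above `c`. If no
  -- threshold had a gap, each would contain some `|τ|`, giving `n > 1 / c ^ 2` distinct eigenvalues
  -- beyond `c`.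
  have h : ∀ k : Fin n, ∃ τ : ℝ, eigenspace K τ ≠ ⊥ ∧ |(|τ| - (c + (2 * (k : ℕ) + 1) * δ))| < δ := by
    intro k
    by_contra h2
    refine hcon ⟨k, k.2, fun τ hτ => ?_⟩
    by_contra h3
    exact h2 ⟨τ, hτ, not_le.1 h3⟩
  choose t ht1 ht2 using h
  have hinj : Function.Injective t := by
    intro k l hkl
    by_contra hne
    have hk := abs_lt.1 (ht2 k)
    have hl := abs_lt.1 (ht2 l)
    rw [hkl] at hk
    rcases lt_or_gt_of_ne (fun h => hne (Fin.ext h) : (k : ℕ) ≠ l) with h | h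
    · have h' : ((k : ℕ) : ℝ) + 1 ≤ (l : ℕ) := by exact_mod_cast h
      nlinarith [hk.2, hl.1]
    · have h' : ((l : ℕ) : ℝ) + 1 ≤ (k : ℕ) := by exact_mod_cast h
      nlinarith [hk.1, hl.2]
  have hcard := card_eigenvalues_mul_le hK hc (F := Finset.univ.image t) (by
    intro τ hτ
    obtain ⟨k, -, rfl⟩ := Finset.mem_image.1 hτ
    refine ⟨?_, ht1 k⟩
    have hk := abs_lt.1 (ht2 k)
    have : (0 : ℝ) ≤ (k : ℕ) * δ := by positivity
    nlinarith [hk.1])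
  rw [Finset.card_image_of_injective _ hinj, Finset.card_univ, Fintype.card_fin] at hcard
  have h1 : ‖K‖ ^ 2 ≤ 1 := by
    have := norm_nonneg K
    nlinarith
  rw [div_lt_iff₀ (by positivity)] at hn
  linarith

/-! ### Cut norm against operator norm -/

theorem kernelForm_eq_inner (K : Kernel μ) {f g : V → ℂ} (hf : MemLp f 2 μ) (hg : MemLp g 2 μ) :
    kernelForm K f g = inner ℂ (outer (hf.toLp f) (hg.toLp g)) K := by
  rw [inner_outer_eq_integral]
  refine integral_congr_ae ?_
  filter_upwards [ae_fst hf.coeFn_toLp, ae_snd hg.coeFn_toLp] with p h1 h2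
  rw [h1, h2]

theorem integrable_kernelForm (K : Kernel μ) {f g : V → ℂ} (hf : MemLp f 2 μ) (hg : MemLp g 2 μ) :
    Integrable (fun p : V × V => conj (f p.1) * K p * g p.2) (μ.prod μ) := by
  refine (L2.integrable_inner (𝕜 := ℂ) (outer (hf.toLp f) (hg.toLp g)) K).congr ?_
  filter_upwards [coeFn_outer (hf.toLp f) (hg.toLp g), ae_fst hf.coeFn_toLp,
    ae_snd hg.coeFn_toLp] with p h h1 h2
  rw [h, h1, h2, RCLike.inner_apply, map_mul, RCLike.conj_conj]
  ring

theorem memLp_of_norm_le_one {f : V → ℂ} (hf : Measurable f) (hf1 : ∀ᵐ x ∂μ, ‖f x‖ ≤ 1) :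
    MemLp f 2 μ :=
  MemLp.of_bound hf.aestronglyMeasurable 1 hf1

theorem norm_toLp_le_one {f : V → ℂ} (hf : MemLp f 2 μ) (hf1 : ∀ᵐ x ∂μ, ‖f x‖ ≤ 1) :
    ‖hf.toLp f‖ ≤ 1 := by
  refine (Lp.norm_le_of_ae_bound zero_le_one ?_).trans_eq ?_
  · filter_upwards [hf.coeFn_toLp, hf1] with x h1 h2
    rwa [h1]
  · simp [measureUnivNNReal]

theorem norm_kernelForm_le_cutNorm (K : Kernel μ) {f g : V → ℂ} (hf : Measurable f)
    (hg : Measurable g) (hf1 : ∀ᵐ x ∂μ, ‖f x‖ ≤ 1) (hg1 : ∀ᵐ x ∂μ, ‖g x‖ ≤ 1) :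
    ‖kernelForm K f g‖ ≤ cutNorm K :=
  le_csSup (cutValues_bddAbove K) ⟨f, g, hf, hg, hf1, hg1, rfl⟩

theorem cutNorm_nonneg (K : Kernel μ) : 0 ≤ cutNorm K := by
  refine Real.sSup_nonneg ?_
  rintro r ⟨f, g, -, -, -, -, rfl⟩
  exact norm_nonneg _

theorem cutNorm_le_norm_op (K : Kernel μ) : cutNorm K ≤ ‖op K‖ := by
  refine csSup_le (cutValues_nonempty K) ?_
  rintro r ⟨f, g, hf, hg, hf1, hg1, rfl⟩
  have hf2 := memLp_of_norm_le_one hf hf1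
  have hg2 := memLp_of_norm_le_one hg hg1
  rw [kernelForm_eq_inner K hf2 hg2]
  refine (norm_inner_outer_kernel_le K _ _).trans ?_
  calc _ ≤ ‖op K‖ * 1 * 1 := by
        gcongr
        · exact norm_toLp_le_one hg2 hg1
        · exact norm_toLp_le_one hf2 hf1
    _ = ‖op K‖ := by ring

theorem cutNorm_le_norm (K : Kernel μ) : cutNorm K ≤ ‖K‖ :=
  (cutNorm_le_norm_op K).trans (norm_op_le K)

theorem cutNorm_sub_le (A B C : Kernel μ) :
    cutNorm (A - B) ≤ cutNorm (A - C) + cutNorm (B - C) := by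
  refine csSup_le (cutValues_nonempty _) ?_
  rintro r ⟨f, g, hf, hg, hf1, hg1, rfl⟩
  have hf2 := memLp_of_norm_le_one hf hf1
  have hg2 := memLp_of_norm_le_one hg hg1
  have h : kernelForm (A - B) f g = kernelForm (A - C) f g - kernelForm (B - C) f g := by
    simp only [kernelForm_eq_inner _ hf2 hg2]
    rw [← inner_sub_right, sub_sub_sub_cancel_right]
  rw [h]
  exact (norm_sub_le _ _).trans (add_le_add (norm_kernelForm_le_cutNorm _ hf hg hf1 hg1)
    (norm_kernelForm_le_cutNorm _ hf hg hf1 hg1))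

theorem cutNorm_sub_comm (A B : Kernel μ) : cutNorm (A - B) = cutNorm (B - A) := by
  have h : ∀ A B : Kernel μ, cutNorm (A - B) ≤ cutNorm (B - A) := fun A B => by
    refine (cutNorm_sub_le A B A).trans_eq ?_
    rw [sub_self, (cutNorm_nonneg (0 : Kernel μ)).antisymm' ((cutNorm_le_norm _).trans_eq
      norm_zero), zero_add]
  exact (h A B).antisymm (h B A)

/-- Indicators are admissible test functions, so the integral over every rectangle vanishes. -/
theorem eq_zero_of_cutNorm_eq_zero {K : Kernel μ} (hK : cutNorm K = 0) : K = 0 := by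
  refine kernel_eq_zero_of_rectangles K fun s t hs ht => ?_
  rw [← inner_outer_indicator K hs ht, ← kernelForm_eq_inner, ← norm_le_zero_iff, ← hK]
  have hb : ∀ s : Set V, ∀ᵐ x ∂μ, ‖s.indicator (fun _ => (1 : ℂ)) x‖ ≤ 1 := fun s =>
    ae_of_all _ fun x => (norm_indicator_le_norm_self _ _).trans_eq norm_one
  exact norm_kernelForm_le_cutNorm K (measurable_const.indicator hs)
    (measurable_const.indicator ht) (hb s) (hb t)

/-- The function `f` cut off where its absolute value exceeds `T`, divided by `T`. -/
def cutoff (T : ℝ) (f : V → ℂ) (x : V) : ℂ :=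
  if ‖f x‖ ≤ T then (T : ℂ)⁻¹ * f x else 0

theorem measurable_cutoff (T : ℝ) {f : V → ℂ} (hf : Measurable f) : Measurable (cutoff T f) :=
  Measurable.ite (measurableSet_le hf.norm measurable_const) (hf.const_mul _) measurable_const

theorem norm_cutoff_le {T : ℝ} (hT : 0 < T) (f : V → ℂ) (x : V) : ‖cutoff T f x‖ ≤ 1 := by
  unfold cutoff
  split_ifs with h
  · rw [norm_mul, norm_inv, Complex.norm_real, Real.norm_of_nonneg hT.le, inv_mul_le_iff₀ hT,
      mul_one]
    exact h
  · simp

theorem norm_sub_cutoff_le {T : ℝ} (hT : 0 < T) (f : V → ℂ) (x : V) :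
    ‖f x - T * cutoff T f x‖ ≤ ‖f x‖ ^ 2 / T := by
  have hT' : (T : ℂ) ≠ 0 := by exact_mod_cast hT.ne'
  unfold cutoff
  split_ifs with h
  · rw [mul_inv_cancel_left₀ hT', sub_self, norm_zero]
    positivity
  · rw [mul_zero, sub_zero, le_div_iff₀ hT, sq]
    gcongr
    exact (not_le.1 h).le

theorem norm_mul_cutoff_le {T : ℝ} (hT : 0 < T) (f : V → ℂ) (x : V) :
    ‖(T : ℂ) * cutoff T f x‖ ≤ ‖f x‖ := by
  have hT' : (T : ℂ) ≠ 0 := by exact_mod_cast hT.ne'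
  unfold cutoff
  split_ifs with h
  · rw [mul_inv_cancel_left₀ hT']
  · simp

theorem norm_form_sub_cutoff_le {T : ℝ} (hT : 0 < T) (f g : V → ℂ) {k : ℂ} (hk : ‖k‖ ≤ 2)
    (x y : V) :
    ‖conj (f x) * k * g y - T ^ 2 * (conj (cutoff T f x) * k * cutoff T g y)‖
      ≤ 1 / T * (‖f x‖ ^ 2 + ‖g y‖ ^ 2 + 2 * (‖f x‖ ^ 2 * ‖g y‖ ^ 2)) := by
  have hid : conj (f x) * k * g y - T ^ 2 * (conj (cutoff T f x) * k * cutoff T g y)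
      = conj (f x - T * cutoff T f x) * k * g y
        + conj (T * cutoff T f x) * k * (g y - T * cutoff T g y) := by
    simp only [map_sub, map_mul, Complex.conj_ofReal]
    ring
  rw [hid]
  have h1 := norm_sub_cutoff_le hT f x
  have h2 := norm_sub_cutoff_le hT g y
  have h3 := norm_mul_cutoff_le hT f x
  calc _ ≤ ‖f x‖ ^ 2 / T * 2 * ‖g y‖ + ‖f x‖ * 2 * (‖g y‖ ^ 2 / T) := by
        refine (norm_add_le _ _).trans ?_
        simp only [norm_mul (_ * _), norm_mul (conj _), RCLike.norm_conj]
        gcongr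
    _ = 1 / T * (‖f x‖ ^ 2 * (2 * ‖g y‖) + (2 * ‖f x‖) * ‖g y‖ ^ 2) := by ring
    -- The bound `2 * t ≤ 1 + t ^ 2` leaves only squares, whose integrals are controlled by the `L₂`
    -- norms.
    _ ≤ 1 / T * (‖f x‖ ^ 2 * (1 + ‖g y‖ ^ 2) + (1 + ‖f x‖ ^ 2) * ‖g y‖ ^ 2) := by
        gcongr
        · nlinarith [sq_nonneg (‖g y‖ - 1)]
        · nlinarith [sq_nonneg (‖f x‖ - 1)]
    _ = _ := by ring

theorem integrable_norm_sq (f : Vec μ) : Integrable (fun x => ‖f x‖ ^ 2) μ :=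
  (memLp_two_iff_integrable_sq_norm (Lp.memLp f).1).1 (Lp.memLp f)

theorem integral_norm_sq (f : Vec μ) : ∫ x, ‖f x‖ ^ 2 ∂μ = ‖f‖ ^ 2 := by
  have h := congrArg Complex.re (L2.inner_def (𝕜 := ℂ) f f)
  rw [inner_self_eq_norm_sq_to_K] at h
  have h2 : ∫ x, inner ℂ (f x) (f x) ∂μ = ((∫ x, ‖f x‖ ^ 2 ∂μ : ℝ) : ℂ) := by
    rw [← integral_complex_ofReal]
    refine integral_congr_ae (ae_of_all _ fun x => ?_)
    simp [inner_self_eq_norm_sq_to_K]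
  rw [h2, Complex.ofReal_re] at h
  rw [← h]
  simp [← Complex.ofReal_pow]

theorem norm_inner_outer_le_cutNorm {K : Kernel μ} (hK : ∀ᵐ p ∂(μ.prod μ), ‖K p‖ ≤ 2) {T : ℝ}
    (hT : 0 < T) {f g : Vec μ} (hf : ‖f‖ ≤ 1) (hg : ‖g‖ ≤ 1) :
    ‖inner ℂ (outer f g) K‖ ≤ T ^ 2 * cutNorm K + 4 / T := by
  have hfm : Measurable f := (Lp.stronglyMeasurable f).measurable
  have hgm : Measurable g := (Lp.stronglyMeasurable g).measurable
  have hf1 : ∀ᵐ x ∂μ, ‖cutoff T f x‖ ≤ 1 := ae_of_all _ (norm_cutoff_le hT f)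
  have hg1 : ∀ᵐ x ∂μ, ‖cutoff T g x‖ ≤ 1 := ae_of_all _ (norm_cutoff_le hT g)
  have hcut := norm_kernelForm_le_cutNorm K (measurable_cutoff T hfm) (measurable_cutoff T hgm)
    hf1 hg1
  have hI := integrable_kernelForm K (Lp.memLp f) (Lp.memLp g)
  have hI' := (integrable_kernelForm K (memLp_of_norm_le_one (measurable_cutoff T hfm) hf1)
    (memLp_of_norm_le_one (measurable_cutoff T hgm) hg1)).const_mul ((T : ℂ) ^ 2)
  have hF : Integrable (fun p : V × V => ‖f p.1‖ ^ 2) (μ.prod μ) :=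
    (integrable_norm_sq f).comp_fst μ
  have hG : Integrable (fun p : V × V => ‖g p.2‖ ^ 2) (μ.prod μ) :=
    (integrable_norm_sq g).comp_snd μ
  have hFaG : Integrable (fun p : V × V => ‖f p.1‖ ^ 2 + ‖g p.2‖ ^ 2) (μ.prod μ) := hF.add hG
  have hFG : Integrable (fun p : V × V => ‖f p.1‖ ^ 2 * ‖g p.2‖ ^ 2) (μ.prod μ) :=
    (integrable_norm_sq f).mul_prod (integrable_norm_sq g)
  have hdiff : ‖inner ℂ (outer f g) K
      - T ^ 2 * kernelForm K (cutoff T f) (cutoff T g)‖ ≤ 4 / T := by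
    rw [inner_outer_eq_integral, kernelForm, ← integral_const_mul, ← integral_sub hI hI']
    refine (norm_integral_le_of_norm_le ((hFaG.add (hFG.const_mul 2)).const_mul (1 / T))
      (by filter_upwards [hK] with p hp using norm_form_sub_cutoff_le hT f g hp p.1 p.2)).trans ?_
    have h1 : ∫ p : V × V, ‖f p.1‖ ^ 2 ∂(μ.prod μ) = ‖f‖ ^ 2 := by
      rw [integral_fun_fst (fun x => ‖f x‖ ^ 2), integral_norm_sq]; simp
    have h2 : ∫ p : V × V, ‖g p.2‖ ^ 2 ∂(μ.prod μ) = ‖g‖ ^ 2 := by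
      rw [integral_fun_snd (fun x => ‖g x‖ ^ 2), integral_norm_sq]; simp
    have h3 : ∫ p : V × V, ‖f p.1‖ ^ 2 * ‖g p.2‖ ^ 2 ∂(μ.prod μ) = ‖f‖ ^ 2 * ‖g‖ ^ 2 := by
      rw [integral_prod_mul (fun x => ‖f x‖ ^ 2) (fun x => ‖g x‖ ^ 2), integral_norm_sq,
        integral_norm_sq]
    have h4 : ∫ p : V × V, 1 / T * (‖f p.1‖ ^ 2 + ‖g p.2‖ ^ 2
        + 2 * (‖f p.1‖ ^ 2 * ‖g p.2‖ ^ 2)) ∂(μ.prod μ)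
        = 1 / T * (‖f‖ ^ 2 + ‖g‖ ^ 2 + 2 * (‖f‖ ^ 2 * ‖g‖ ^ 2)) := by
      rw [integral_const_mul, integral_add hFaG (hFG.const_mul 2), integral_add hF hG,
        integral_const_mul, h1, h2, h3]
    refine h4.le.trans ?_
    calc _ ≤ 1 / T * (1 ^ 2 + 1 ^ 2 + 2 * (1 ^ 2 * 1 ^ 2)) := by gcongr
      _ = 4 / T := by ring
  have h := norm_le_norm_add_norm_sub' (inner ℂ (outer f g) K)
    (T ^ 2 * kernelForm K (cutoff T f) (cutoff T g))
  refine h.trans (add_le_add ?_ hdiff)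
  rw [norm_mul, norm_pow, Complex.norm_real, Real.norm_of_nonneg hT.le]
  gcongr

/-- For bounded kernels, the operator norm is controlled by the cut norm. -/
theorem norm_op_le_cutNorm {K : Kernel μ} (hK : ∀ᵐ p ∂(μ.prod μ), ‖K p‖ ≤ 2) {T : ℝ}
    (hT : 0 < T) : ‖op K‖ ≤ T ^ 2 * cutNorm K + 4 / T := by
  have hC : 0 ≤ T ^ 2 * cutNorm K + 4 / T := by
    have := cutNorm_nonneg K
    positivity
  refine ContinuousLinearMap.opNorm_le_of_unit_norm hC fun f hf => ?_
  by_cases h0 : op K f = 0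
  · rwa [h0, norm_zero]
  have hn : ‖op K f‖ ≠ 0 := norm_ne_zero_iff.2 h0
  -- The unit vector in the direction of `op K f` turns the bound on the form into a bound on `‖op K
  -- f‖`.
  have hg : ‖((‖op K f‖ : ℂ)⁻¹ • op K f)‖ = 1 := by
    rw [norm_smul, norm_inv, Complex.norm_real, norm_norm, inv_mul_cancel₀ hn]
  have h := norm_inner_outer_le_cutNorm hK hT hg.le hf.le
  rw [← inner_op_right, inner_smul_left, inner_self_eq_norm_sq_to_K, map_inv₀,
    Complex.conj_ofReal, norm_mul, norm_inv, norm_pow] at h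
  simp only [Complex.coe_algebraMap, Complex.norm_real, norm_norm] at h
  rwa [sq (‖op K f‖), inv_mul_cancel_left₀ hn] at h

/-! ### The two implications -/

theorem norm_le_one_of_mem_unitKernels {K : Kernel μ} (hK : K ∈ unitKernels μ) : ‖K‖ ≤ 1 := by
  refine (Lp.norm_le_of_ae_bound zero_le_one hK.2).trans_eq ?_
  simp [measureUnivNNReal]

theorem ae_norm_sub_le_two {K L : Kernel μ} (hK : K ∈ unitKernels μ) (hL : L ∈ unitKernels μ) :
    ∀ᵐ p ∂(μ.prod μ), ‖(K - L : Kernel μ) p‖ ≤ 2 := by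
  filter_upwards [hK.2, hL.2, Lp.coeFn_sub K L] with p h1 h2 h3
  rw [h3, Pi.sub_apply]
  exact (norm_sub_le _ _).trans (by linarith)

theorem CutTendsto.unique {M : ℕ → Kernel μ} {K L : Kernel μ} (hK : CutTendsto M K)
    (hL : CutTendsto M L) : K = L := by
  have h : Tendsto (fun i => cutNorm (M i - K) + cutNorm (M i - L)) atTop (𝓝 (0 + 0)) :=
    Tendsto.add hK hL
  rw [add_zero] at h
  refine sub_eq_zero.1 (eq_zero_of_cutNorm_eq_zero
    (le_antisymm (ge_of_tendsto' h fun i => ?_) (cutNorm_nonneg _)))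
  rw [cutNorm_sub_comm (M i) K, cutNorm_sub_comm (M i) L]
  exact cutNorm_sub_le K L (M i)

theorem CutTendsto.exists_norm_op_sub_lt {M : ℕ → Kernel μ} (hM : ∀ i, M i ∈ unitKernels μ)
    {K : Kernel μ} (hK : CutTendsto M K) {ε : ℝ} (hε : 0 < ε) :
    ∃ N, ∀ i ≥ N, ∀ k ≥ N, ‖op (M i - M k)‖ < ε := by
  -- With `T = 8 / ε` the cutoff error `4 / T` is `ε / 2`; cut norm distances below `ε / (4 * T ^
  -- 2)` to the limit keep the other term below `ε / 2`.
  have hT : 0 < 8 / ε := by positivity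
  obtain ⟨N, hN⟩ := eventually_atTop.1
    (hK.eventually_lt_const (u := ε / (4 * (8 / ε) ^ 2)) (by positivity))
  refine ⟨N, fun i hi k hk => ?_⟩
  refine (norm_op_le_cutNorm (ae_norm_sub_le_two (hM i) (hM k)) hT).trans_lt ?_
  have h : cutNorm (M i - M k) < 2 * (ε / (4 * (8 / ε) ^ 2)) := by
    linarith [cutNorm_sub_le (M i) (M k) K, hN i hi, hN k hk]
  calc _ < (8 / ε) ^ 2 * (2 * (ε / (4 * (8 / ε) ^ 2))) + 4 / (8 / ε) := by gcongr
    _ = ε := by field_simp; norm_num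

/-- Along a cut norm convergent sequence, the truncations converge at some threshold between
`c` and `2 c`. -/
theorem CutTendsto.exists_tendsto_trunc {M : ℕ → Kernel μ} (hM : ∀ i, M i ∈ unitKernels μ)
    {K : Kernel μ} (hK : CutTendsto M K) {c : ℝ} (hc : 0 < c) :
    ∃ a, c < a ∧ a ≤ 2 * c ∧ ∃ L, Tendsto (fun i => trunc (M i) a) atTop (𝓝 L) := by
  obtain ⟨n, hn⟩ := exists_nat_gt (1 / c ^ 2)
  have hn0 : (0 : ℝ) < n := lt_trans (by positivity) hn
  -- With `2 * n * δ = c`, all `n` thresholds `c + (2 * k + 1) * δ` lie strictly between `c` and `2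
  -- * c`.
  set δ := c / (2 * n) with hδ_def
  have hδ : 0 < δ := by positivity
  have hM1 := fun i => norm_le_one_of_mem_unitKernels (hM i)
  -- Pigeonhole: if every threshold eventually failed, some `M i` would have no gap at any of them.
  obtain ⟨k, hkn, hk⟩ : ∃ k < n, ∃ᶠ i in atTop, HasGap (M i) (c + (2 * k + 1) * δ) δ := by
    by_contra hcon
    have h1 : ∀ k ∈ Finset.range n, ∀ᶠ i in atTop, ¬ HasGap (M i) (c + (2 * k + 1) * δ) δ := by
      intro k hk
      by_contra h2
      exact hcon ⟨k, Finset.mem_range.1 hk, h2⟩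
    obtain ⟨i, hi⟩ := ((eventually_all_finset _).2 h1).exists
    obtain ⟨k, hkn, hk⟩ := exists_hasGap (hM i).1 (hM1 i) hc hδ hn
    exact hi k (Finset.mem_range.2 hkn) hk
  have hk' : ((k : ℕ) : ℝ) + 1 ≤ n := by exact_mod_cast hkn
  have hnδ : 2 * n * δ = c := by rw [hδ_def]; field_simp
  have hkδ : (0 : ℝ) ≤ k * δ := by positivity
  set a := c + (2 * k + 1) * δ with ha_def
  have hca : c + δ ≤ a := by rw [ha_def]; linarith
  have ha2 : a ≤ 2 * c := by rw [ha_def]; nlinarith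
  have hδa : δ < a := by linarith
  have ha0 : 0 < a := hδ.trans hδa
  refine ⟨a, by linarith, ha2, cauchySeq_tendsto_of_complete (Metric.cauchySeq_iff'.2 ?_)⟩
  intro ε hε
  set C := 2 / a * (1 + 2 / δ) with hC_def
  have hC : 0 < C := by positivity
  obtain ⟨N, hN⟩ := hK.exists_norm_op_sub_lt hM (ε := ε ^ 2 / C) (by positivity)
  -- A single late index `m` with a gap suffices: all later truncations are compared with that of `M
  -- m`, and the estimate asks for a gap on one side only.
  obtain ⟨m, hmN, hm⟩ := frequently_atTop.1 hk N
  refine ⟨m, fun i hi => ?_⟩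
  rw [dist_eq_norm, ← sq_lt_sq₀ (norm_nonneg _) hε.le]
  refine (norm_trunc_sub_trunc_sq_le (hM i).1 (hM m).1 (hM1 i) (hM1 m) hδ hδa hm).trans_lt ?_
  have h := hN i (hmN.trans hi) m hmN
  rw [lt_div_iff₀ hC] at h
  linarith

theorem CutTendsto.exists_isTruncationScale {M : ℕ → Kernel μ} (hM : ∀ i, M i ∈ unitKernels μ)
    {K : Kernel μ} (hK : CutTendsto M K) : ∃ α : ℕ → ℝ, IsTruncationScale M α := by
  have hpos : ∀ j : ℕ, (0 : ℝ) < (1 / 2) ^ j := fun j => by positivity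
  -- The bounds `(1 / 2) ^ j < α j ≤ 2 * (1 / 2) ^ j` make consecutive ranges abut, so `α` is
  -- decreasing.
  choose α h1 h2 h3 using fun j : ℕ => hK.exists_tendsto_trunc hM (hpos j)
  refine ⟨α, antitone_nat_of_succ_le fun j => ?_, fun j => (hpos j).trans (h1 j), ?_, h3⟩
  · refine (h2 (j + 1)).trans (le_trans (le_of_eq ?_) (h1 j).le)
    rw [pow_succ]
    ring
  · have h : Tendsto (fun j : ℕ => 2 * (1 / 2 : ℝ) ^ j) atTop (𝓝 (2 * 0)) :=
      (tendsto_pow_atTop_nhds_zero_of_lt_one (by norm_num) (by norm_num)).const_mul 2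
    rw [mul_zero] at h
    exact squeeze_zero (fun j => ((hpos j).trans (h1 j)).le) h2 h

/-- The limits of the truncations converge, and their limit is the cut norm limit. -/
theorem IsTruncationScale.exists_tendsto {M : ℕ → Kernel μ} (hM : ∀ i, M i ∈ unitKernels μ)
    {α : ℕ → ℝ} (hα : IsTruncationScale M α) {L : ℕ → Kernel μ}
    (hL : ∀ j, Tendsto (fun i => trunc (M i) (α j)) atTop (𝓝 (L j))) :
    ∃ K : Kernel μ, Tendsto L atTop (𝓝 K) ∧ CutTendsto M K := by
  obtain ⟨hanti, hpos, hlim, -⟩ := hα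
  have hM1 := fun i => norm_le_one_of_mem_unitKernels (hM i)
  have hsq : ∀ j k, j ≤ k → ‖L k - L j‖ ^ 2 = ‖L k‖ ^ 2 - ‖L j‖ ^ 2 := by
    intro j k hjk
    refine tendsto_nhds_unique (((hL k).sub (hL j)).norm.pow 2) ?_
    simp only [norm_trunc_sub_trunc_sq (hM _).1 (hpos k) (hanti hjk)]
    exact ((hL k).norm.pow 2).sub ((hL j).norm.pow 2)
  have hmono : Monotone fun j => ‖L j‖ ^ 2 := fun j k hjk => by
    have := hsq j k hjk
    have h2 := sq_nonneg ‖L k - L j‖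
    change ‖L j‖ ^ 2 ≤ ‖L k‖ ^ 2
    linarith
  have hbdd : ∀ j, ‖L j‖ ≤ 1 := fun j =>
    le_of_tendsto' (hL j).norm fun i => (norm_trunc_le (hM i).1 (hpos j)).trans (hM1 i)
  have hconv := tendsto_atTop_ciSup hmono ⟨1, by
    rintro _ ⟨j, rfl⟩
    exact pow_le_one₀ (norm_nonneg _) (hbdd j)⟩
  have hcauchy : CauchySeq L := by
    rw [Metric.cauchySeq_iff']
    intro ε hε
    obtain ⟨N, hN⟩ := Metric.cauchySeq_iff'.1 hconv.cauchySeq (ε ^ 2) (by positivity)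
    refine ⟨N, fun n hn => ?_⟩
    rw [dist_eq_norm, ← sq_lt_sq₀ (norm_nonneg _) hε.le, hsq N n hn]
    exact (le_abs_self _).trans_lt (hN n hn)
  obtain ⟨K, hK⟩ := cauchySeq_tendsto_of_complete hcauchy
  refine ⟨K, hK, ?_⟩
  rw [CutTendsto, Metric.tendsto_nhds]
  intro ε hε
  -- Three errors of `ε / 3`: the discarded part of `M i`, the distance of its truncation to `L j`,
  -- and that of `L j` to `K`.
  obtain ⟨j, hj1, hj2⟩ := ((hlim.eventually_lt_const (by positivity : 0 < ε / 3)).and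
    (Metric.tendsto_nhds.1 hK (ε / 3) (by positivity))).exists
  filter_upwards [Metric.tendsto_nhds.1 (hL j) (ε / 3) (by positivity)] with i hi
  rw [Real.dist_eq, sub_zero, abs_of_nonneg (cutNorm_nonneg _)]
  have h1 : cutNorm (M i - trunc (M i) (α j)) ≤ α j :=
    (cutNorm_le_norm_op _).trans (norm_op_sub_trunc_le (hM i).1 (hpos j))
  have h2 : cutNorm (K - trunc (M i) (α j)) ≤ dist (trunc (M i) (α j)) K :=
    (cutNorm_le_norm _).trans_eq (by rw [dist_comm, dist_eq_norm])
  linarith [cutNorm_sub_le (M i) K (trunc (M i) (α j)), dist_triangle (trunc (M i) (α j)) (L j) K]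

end KernelOperator
end

theorem mainTheorem3 {V : Type*} [MeasurableSpace V] (μ : Measure V) [IsProbabilityMeasure μ]
    (M : ℕ → KernelOperator.Kernel μ) (hM : ∀ i, M i ∈ KernelOperator.unitKernels μ) :
    ((∃ K : KernelOperator.Kernel μ, KernelOperator.CutTendsto M K) ↔
      ∃ α : ℕ → ℝ, KernelOperator.IsTruncationScale M α) ∧
    ∀ α : ℕ → ℝ, KernelOperator.IsTruncationScale M α →
      ∀ L : ℕ → KernelOperator.Kernel μ,
        (∀ j, Tendsto (fun i => KernelOperator.trunc (M i) (α j)) atTop (𝓝 (L j))) →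
        ∀ K : KernelOperator.Kernel μ, KernelOperator.CutTendsto M K →
          Tendsto L atTop (𝓝 K) := by
  refine ⟨⟨fun ⟨K, hK⟩ => hK.exists_isTruncationScale hM, fun ⟨α, hα⟩ => ?_⟩, ?_⟩
  · choose L hL using hα.2.2.2
    obtain ⟨K, -, hK⟩ := hα.exists_tendsto hM hL
    exact ⟨K, hK⟩
  · intro α hα L hL K hK
    obtain ⟨K', hLK', hK'⟩ := hα.exists_tendsto hM hL
    -- The given cut norm limit is arbitrary, so it is matched with the constructed one by
    -- uniqueness of cut norm limits.
    rwa [hK.unique hK']
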